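/- Let $\langle x,y\rangle_H=x_1y_1+\dots+x_my_m-x_{m+1}y_{m+1}$ on $\mathbb R^{m+1}$, let $\mathbb H^m=\{x:\langle x,x\rangle_H=-1,\ x_{m+1}>0\}$ be hyperbolic space with distance $d_H(x,y)=\operatorname{arcosh}(-\langle x,y\rangle_H)$, and let $\Gamma$ be a discrete group of linear automorphisms of $\mathbb R^{m+1}$ preserving $\langle\cdot,\cdot\rangle_H$ and the future cone $\{x : \langle x,x\rangle_H<0,\ x_{m+1}>0\}$, acting freely on $\mathbb H^m$ with compact quotient. Let $M=\mathbb H^m/\Gamma$ be the resulting compact hyperbolic manifold, $\pi_\Gamma:\mathbb H^m\to M$ the covering map, $d_M$ the geodesic distance and $\sigma_M$ the Riemannian measure of $M$. Let $\mu$ be a probability measure on $M$ with a positive continuous density with respect to $\sigma_M$, $d\mu=f\,d\sigma_M$. Let $\nu=\sum_{i=1}^k\nu_i\delta_{p_i}$ with distinct points $p_1,\dots,p_k\in M$, $\min_i\nu_i>0$ and $\sum_{i=1}^k\nu_i=\mu(M)$. Choose $x_i\in\mathbb H^m$ with $\pi_\Gamma(x_i)=p_i$, and for $\varphi\in\mathbb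 R^k$ put $$W_i(\varphi)=\pi_\Gamma\{y\in\mathbb H^m:\ e^{-\varphi_i}\langle x_i,y\rangle_H\ge e^{-\varphi_j}\langle\beta x_j,y\rangle_H\ \ \forall\,1\le j\le k,\ \forall\beta\in\Gamma\}.$$ Then there exists a height vector $\varphi\in\mathbb R^k$ with $\mu(W_i(\varphi))=\nu_i$ for all $i$, and it is unique up to adding a constant vector $(c,\dots,c)$. Let $$\Phi=\{\varphi\in\mathbb R^k:\ \mu(W_i(\varphi))>0\ \ \forall\,1\le i\le k\}$$ be the admissible height space. It is convex and contains $0$; the energy $$E(\varphi)=\int_0^{\varphi}\sum_{i=1}^k\mu(W_i(\varphi))\,d\varphi_i-\sum_{i=1}^k\varphi_i\nu_i$$ (a line integral along any $C^1$ path in $\Phi$ from $0$ to $\varphi$) is well defined, that is, independent of the path, and convex on $\Phi$. Every height vector $\varphi$ with $\mu(W_i(\varphi))=\nu_i$ for all $i$ lies in $\Phi$ and minimizes $E$ over $\Phi$. Furthermore, for such $\varphi$, $\mu$-almost every point of $M$ lies in exactly one $W_i(\varphi)$, and the ($\mu$-almost everywhere defined) map $T: W_i(\varphi)\mapsto p_i$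 is a measure-preserving map $(M,\mu)\to(M,\nu)$ which, among all measure-preserving maps $(M,\mu)\to(M,\nu)$, minimizes the hyperbolic transport cost $$\int_M\ln\cosh d_M(x,T(x))\,d\mu(x).$$ -/

import Mathlib

open MeasureTheory Matrix

noncomputable section

namespace HypOT

/-- The Lorentzian inner product on `ℝ^{m+1}` (the last coordinate is the time coordinate). -/
def lorentz {m : ℕ} (x y : Fin (m + 1) → ℝ) : ℝ :=
  (∑ i : Fin m, x i.castSucc * y i.castSucc) - x (Fin.last m) * y (Fin.last m)

/-- The future cone of Minkowski space. -/
def futureCone (m : ℕ) : Set (Fin (m + 1) → ℝ) :=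
  {x | lorentz x x < 0 ∧ 0 < x (Fin.last m)}

/-- The hyperboloid model of `m`-dimensional hyperbolic space, with the topology and the Borel
structure induced from `ℝ^{m+1}`. (The ambient sup distance that the subtype also inherits is
never used; the hyperbolic distance is `hypDist`.) -/
abbrev Hyp (m : ℕ) : Type :=
  {x : Fin (m + 1) → ℝ // lorentz x x = -1 ∧ 0 < x (Fin.last m)}

/-- The hyperbolic distance. -/
def hypDist {m : ℕ} (x y : Hyp m) : ℝ := Real.arcosh (-lorentz x.1 y.1)

/-- The group of linear automorphisms of `ℝ^{m+1}` preserving the Lorentzian inner product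
and the future cone; it carries the topology of matrices. -/
def lorentzGroup (m : ℕ) : Subgroup (GL (Fin (m + 1)) ℝ) where
  carrier := {A | (∀ x y, lorentz (A.1 *ᵥ x) (A.1 *ᵥ y) = lorentz x y) ∧
    ∀ x, A.1 *ᵥ x ∈ futureCone m ↔ x ∈ futureCone m}
  mul_mem' := by
    rintro A B ⟨hA, hA'⟩ ⟨hB, hB'⟩
    refine ⟨fun x y => ?_, fun x => ?_⟩
    · rw [Units.val_mul, ← mulVec_mulVec, ← mulVec_mulVec, hA, hB]
    · rw [Units.val_mul, ← mulVec_mulVec, hA', hB']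
  one_mem' := by
    refine ⟨fun x y => ?_, fun x => ?_⟩ <;> simp
  inv_mem' := by
    rintro A ⟨hA, hA'⟩
    have key : ∀ x, A.1 *ᵥ ((A⁻¹).1 *ᵥ x) = x := fun x => by
      rw [mulVec_mulVec, ← Units.val_mul, mul_inv_cancel, Units.val_one, one_mulVec]
    refine ⟨fun x y => ?_, fun x => ?_⟩
    · rw [← hA, key, key]
    · rw [← hA', key]

/-- The action of the Lorentz group on hyperbolic space by matrix multiplication. -/
instance (m : ℕ) : MulAction (lorentzGroup m) (Hyp m) where
  smul A x := ⟨A.1.1 *ᵥ x.1, by rw [A.2.1]; exact x.2.1,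
    ((A.2.2 x.1).2 ⟨by rw [x.2.1]; norm_num, x.2.2⟩).2⟩
  one_smul x := Subtype.ext (one_mulVec x.1)
  mul_smul A B x := Subtype.ext (mulVec_mulVec x.1 A.1.1 B.1.1).symm

/-- The parametrization of hyperbolic space as a graph over `ℝ^m`, in `ℝ^{m+1}`. -/
def graphMap (m : ℕ) (u : Fin m → ℝ) : Fin (m + 1) → ℝ :=
  Fin.snoc u (Real.sqrt (1 + ∑ i, u i ^ 2))

lemma graphMap_mem (m : ℕ) (u : Fin m → ℝ) :
    lorentz (graphMap m u) (graphMap m u) = -1 ∧ 0 < graphMap m u (Fin.last m) := by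
  have h : 0 < 1 + ∑ i, u i ^ 2 := by positivity
  constructor
  · simp only [lorentz, graphMap, Fin.snoc_castSucc, Fin.snoc_last]
    rw [Real.mul_self_sqrt h.le]
    simp only [pow_two]
    ring
  · simpa [graphMap] using h

/-- The global chart of hyperbolic space inverse to the orthogonal projection to `ℝ^m`. -/
def hypChart (m : ℕ) (u : Fin m → ℝ) : Hyp m := ⟨graphMap m u, graphMap_mem m u⟩

/-- The coefficients `g_{ij} = ⟨∂_i, ∂_j⟩` in this chart of the Riemannian metric of hyperbolic
space, i.e. of the restriction of the Lorentzian inner product to its tangent spaces. -/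
def metricMatrix (m : ℕ) (u : Fin m → ℝ) : Matrix (Fin m) (Fin m) ℝ :=
  Matrix.of fun i j => lorentz (fderiv ℝ (graphMap m) u (Pi.single i 1))
    (fderiv ℝ (graphMap m) u (Pi.single j 1))

/-- The Riemannian measure of hyperbolic space: `√(det g) du` in the global chart. -/
def hypMeasure (m : ℕ) : Measure (Hyp m) :=
  ((volume : Measure (Fin m → ℝ)).withDensity
    fun u => ENNReal.ofReal (Real.sqrt (metricMatrix m u).det)).map (hypChart m)

section Manifold

variable {m : ℕ} (Γ : Subgroup (lorentzGroup m))

/-- The quotient `ℍ^m / Γ`. -/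
def HypQuot : Type := Quotient (MulAction.orbitRel Γ (Hyp m))

/-- The quotient topology. -/
instance : TopologicalSpace (HypQuot Γ) :=
  inferInstanceAs (TopologicalSpace (Quotient (MulAction.orbitRel Γ (Hyp m))))

/-- The Borel structure of the quotient topology. -/
instance : MeasurableSpace (HypQuot Γ) := borel _

instance : BorelSpace (HypQuot Γ) := ⟨rfl⟩

/-- The covering map `π_Γ : ℍ^m → ℍ^m / Γ`. -/
def proj (x : Hyp m) : HypQuot Γ := Quotient.mk (MulAction.orbitRel Γ (Hyp m)) x

/-- `Γ` is discrete, acts freely on `ℍ^m`, and the quotient `ℍ^m / Γ` is compact, so that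
`ℍ^m / Γ` is a compact hyperbolic manifold. -/
structure IsCocompactFree : Prop where
  discrete : DiscreteTopology Γ
  free : ∀ (γ : Γ) (x : Hyp m), γ • x = x → γ = 1
  compact : CompactSpace (HypQuot Γ)

/-- The geodesic distance `d_M` of `M = ℍ^m / Γ`: the smallest distance between points of the
two fibres (geodesics of `M` lift to geodesics of `ℍ^m` of the same length). -/
def quotDist (p q : HypQuot Γ) : ℝ :=
  sInf {r | ∃ x y : Hyp m, proj Γ x = p ∧ proj Γ y = q ∧ hypDist x y = r}

/-- The Riemannian measure `σ_M` of `M = ℍ^m / Γ`. The covering map is a local isometry, so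
it carries the Riemannian measure of any Borel set on which it is injective to that of its image;
`σ_M` is the supremum, in the lattice of measures, of all the measures obtained from such sets
(it is attained at any Borel set containing one point of each orbit). -/
def quotMeasure : Measure (HypQuot Γ) :=
  ⨆ (B : Set (Hyp m)) (_ : MeasurableSet B) (_ : Set.InjOn (proj Γ) B),
    ((hypMeasure m).restrict B).map (proj Γ)

variable {k : ℕ}

/-- The cell `U_i(φ) ⊆ ℍ^m` for the heights `φ` and the points `x_1, …, x_k ∈ ℍ^m`. -/
def cellUp (x : Fin k → Hyp m) (φ : Fin k → ℝ) (i : Fin k) : Set (Hyp m) :=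
  {y | ∀ (j : Fin k) (β : Γ),
    Real.exp (-φ j) * lorentz (β • x j).1 y.1 ≤ Real.exp (-φ i) * lorentz (x i).1 y.1}

/-- The cell `W_i(φ) = π_Γ(U_i(φ)) ⊆ M`. -/
def cell (x : Fin k → Hyp m) (φ : Fin k → ℝ) (i : Fin k) : Set (HypQuot Γ) :=
  proj Γ '' cellUp Γ x φ i

variable (μ : Measure (HypQuot Γ)) (x : Fin k → Hyp m)

/-- The admissible height space `Φ`. -/
def admissible : Set (Fin k → ℝ) := {φ | ∀ i, 0 < μ.real (cell Γ x φ i)}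

/-- The differential form `∑ i, μ(W_i(φ)) dφ_i` on `ℝ^k`. -/
def cellForm (φ : Fin k → ℝ) : (Fin k → ℝ) →L[ℝ] ℝ :=
  ∑ i, μ.real (cell Γ x φ i) • ContinuousLinearMap.proj (R := ℝ) (φ := fun _ : Fin k => ℝ) i

/-- The energy `E(φ) = ∫_0^φ ∑ i, μ(W_i(φ)) dφ_i - ∑ i, φ_i ν_i`, with the line integral taken
along the straight segment from `0` to `φ`. -/
def energy (w φ : Fin k → ℝ) : ℝ :=
  curveIntegral (cellForm Γ μ x) (Path.segment 0 φ) - ∑ i, φ i * w i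

variable {Γ}

/-- The discrete measure `∑ i, w_i δ_{p_i}`. -/
def discreteMeasure (p : Fin k → HypQuot Γ) (w : Fin k → ℝ) : Measure (HypQuot Γ) :=
  ∑ i, ENNReal.ofReal (w i) • Measure.dirac (p i)

/-- The hyperbolic transport cost `c = ln cosh d_M`. -/
def cost (p q : HypQuot Γ) : ℝ := Real.log (Real.cosh (quotDist Γ p q))

/-- `T` is a measure-preserving map from `μ` to `ν` that minimizes the hyperbolic transport cost
among all such maps (all of which have integrable cost). -/
def IsOptimalTransportMap (μ ν : Measure (HypQuot Γ)) (T : HypQuot Γ → HypQuot Γ) : Prop :=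
  MeasurePreserving T μ ν ∧ Integrable (fun q => cost q (T q)) μ ∧
    ∀ S : HypQuot Γ → HypQuot Γ, MeasurePreserving S μ ν →
      Integrable (fun q => cost q (S q)) μ ∧ ∫ q, cost q (T q) ∂μ ≤ ∫ q, cost q (S q) ∂μ

end Manifold

end HypOT

end

/-!
For `q = π_Γ(y)` the cost `c_i(q) = ln cosh d_M(q, p_i)` is the minimum over `β ∈ Γ` of
`ln (-⟨β x_i, y⟩)`, so `W_i(φ)` is the Laguerre cell `{c_i - φ_i ≤ c_j - φ_j ∀ j}` of a semidiscrete
transport problem on `M` (`HypOT.cell_eq_laguerreCell`). The minimum is attained, and `c_i` is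
continuous, because a discrete group of Lorentz transformations acts properly
(`HypOT.finite_neg_lorentz_le`). A tie `c_i - c_j = a` with `i ≠ j` lifts to a countable union of
sections of the hyperboloid by linear hyperplanes, so it is negligible
(`HypOT.quotMeasure_cost_sub_cost_eq_zero`).

The statements about heights come from the convex function `P(φ) = ∫ max_i (φ_i - c_i) dμ`. The
masses of the cells form a subgradient of `P` and, ties being negligible, depend continuously on
`φ`. Hence `P` is differentiable with `dP = ∑ i, μ(W_i(φ)) dφ_i`, line integrals of this form depend
only on the endpoints, and `E(φ) = P(φ) - P(0) - ∑ i, φ_i ν_i` is convex, with the solutions of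
`μ(W_i(φ)) = ν_i` as its minimizers. A solution exists since `E` is coercive modulo constants
(`SemidiscreteOT.IsGenericCost.exists_heights`). It is unique modulo constants since `M` is
connected and nonempty open sets have positive mass: if `ψ - φ` is not constant, the union of the
cells of the indices where it is maximal strictly grows from `φ` to `ψ`
(`SemidiscreteOT.IsGenericCost.heights_unique`). Optimality of the induced map is Kantorovich
duality (`SemidiscreteOT.IsGenericCost.integral_cost_le`).

Convexity of the admissible space depends on the particular cost. Nonemptiness of the `i`-th open
cell means that some future vector `z` has `-⟨x_i, z⟩ = 1` and
`ln (-⟨β x_j, z⟩) > φ_j - φ_i` for all `β` and all `j ≠ i`; by concavity of the logarithm, a convex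
combination of such vectors serves for the convex combination of the heights
(`HypOT.exists_strict_convex_comb`).
-/

/-! ### Semidiscrete optimal transport -/

namespace SemidiscreteOT

open Filter Topology

variable {M ι : Type*} [Fintype ι]

/-- The (closed) Laguerre cell of the index `i`: the points at which `i` minimizes the cost `c i`
discounted by the height `φ i`. -/
def laguerreCell (c : ι → M → ℝ) (φ : ι → ℝ) (i : ι) : Set M :=
  {q | ∀ j, c i q - φ i ≤ c j q - φ j}

/-- The upper envelope `max_i (φ i - c i q)`, i.e. minus the cost-transform of the heights. -/
noncomputable def envelope (c : ι → M → ℝ) (φ : ι → ℝ) (q : M) : ℝ := ⨆ i, (φ i - c i q)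

lemma le_envelope (c : ι → M → ℝ) (φ : ι → ℝ) (q : M) (i : ι) :
    φ i - c i q ≤ envelope c φ q :=
  le_ciSup (f := fun i => φ i - c i q) (Set.finite_range _).bddAbove i

omit [Fintype ι] in
lemma envelope_le [Nonempty ι] {c : ι → M → ℝ} {φ : ι → ℝ} {q : M} {a : ℝ}
    (h : ∀ i, φ i - c i q ≤ a) : envelope c φ q ≤ a := ciSup_le h

lemma envelope_eq_of_mem {c : ι → M → ℝ} {φ : ι → ℝ} {q : M} {i : ι}
    (h : q ∈ laguerreCell c φ i) : envelope c φ q = φ i - c i q :=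
  haveI : Nonempty ι := ⟨i⟩
  le_antisymm (envelope_le fun j => by linarith [h j]) (le_envelope c φ q i)

lemma exists_mem_laguerreCell [Nonempty ι] (c : ι → M → ℝ) (φ : ι → ℝ) (q : M) :
    ∃ i, q ∈ laguerreCell c φ i := by
  obtain ⟨i, -, hi⟩ := Finset.exists_min_image Finset.univ (fun i => c i q - φ i)
    Finset.univ_nonempty
  exact ⟨i, fun j => hi j (Finset.mem_univ j)⟩

omit [Fintype ι] in
/-- The union of the cells of the indices in `I` does not depend on the comparison of these indices
among themselves. -/
lemma mem_biUnion_laguerreCell_iff (c : ι → M → ℝ) (φ : ι → ℝ) (I : Finset ι) (q : M) :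
    q ∈ ⋃ i ∈ I, laguerreCell c φ i ↔ ∃ i ∈ I, ∀ j ∉ I, c i q - φ i ≤ c j q - φ j := by
  simp only [Set.mem_iUnion, exists_prop]
  refine ⟨fun ⟨i, hi, h⟩ => ⟨i, hi, fun j _ => h j⟩, fun ⟨i, hi, h⟩ => ?_⟩
  obtain ⟨a, ha, hmin⟩ := Finset.exists_min_image I (fun i => c i q - φ i) ⟨i, hi⟩
  refine ⟨a, ha, fun j => ?_⟩
  by_cases hj : j ∈ I
  · exact hmin j hj
  · exact (hmin i hi).trans (h j hj)

omit [Fintype ι] in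
lemma laguerreCell_add_const (c : ι → M → ℝ) (φ : ι → ℝ) (a : ℝ) (i : ι) :
    laguerreCell c (fun i => φ i + a) i = laguerreCell c φ i := by
  ext q
  simp only [laguerreCell, Set.mem_ofPred_eq]
  exact forall_congr' fun j => by constructor <;> intro h <;> linarith

section Measure

variable [MeasurableSpace M]

/-- A finite family of bounded measurable costs all of whose ties, for all differences of heights,
are negligible. -/
structure IsGenericCost (μ : Measure M) (c : ι → M → ℝ) : Prop where
  measurable : ∀ i, Measurable (c i)
  bounded : ∃ C, ∀ i q, |c i q| ≤ C
  null_tie : ∀ i j, i ≠ j → ∀ a, μ {q | c i q - c j q = a} = 0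

/-- The Kantorovich potential `∫ max_i (φ i - c i) dμ`, a convex function of the heights. -/
noncomputable def potential (μ : Measure M) (c : ι → M → ℝ) (φ : ι → ℝ) : ℝ :=
  ∫ q, envelope c φ q ∂μ

/-- The differential form `∑ i, μ(V_i(φ)) dφ_i`, where `V_i(φ)` are the Laguerre cells. -/
noncomputable def massForm (μ : Measure M) (c : ι → M → ℝ) (φ : ι → ℝ) : (ι → ℝ) →L[ℝ] ℝ :=
  ∑ i, μ.real (laguerreCell c φ i) •
    ContinuousLinearMap.proj (R := ℝ) (φ := fun _ : ι => ℝ) i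

lemma massForm_apply (μ : Measure M) (c : ι → M → ℝ) (φ v : ι → ℝ) :
    massForm μ c φ v = ∑ i, μ.real (laguerreCell c φ i) * v i := by
  simp [massForm]

namespace IsGenericCost

variable {μ : Measure M} {c : ι → M → ℝ} (hc : IsGenericCost μ c)
include hc

lemma measurableSet_cell (φ : ι → ℝ) (i : ι) : MeasurableSet (laguerreCell c φ i) := by
  have : laguerreCell c φ i = ⋂ j, {q | c i q - φ i ≤ c j q - φ j} := by
    ext q; simp [laguerreCell]
  rw [this]
  exact .iInter fun j => measurableSet_le ((hc.measurable i).sub_const _)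
    ((hc.measurable j).sub_const _)

lemma ae_ne (φ : ι → ℝ) : ∀ᵐ q ∂μ, ∀ i j, i ≠ j → c i q - φ i ≠ c j q - φ j := by
  refine ae_all_iff.2 fun i => ae_all_iff.2 fun j => ?_
  by_cases hij : i = j
  · simp [hij]
  · have h : ∀ᵐ q ∂μ, ¬ (c i q - c j q = φ i - φ j) := by
      simpa [ae_iff] using hc.null_tie i j hij (φ i - φ j)
    filter_upwards [h] with q hq _ h'
    exact hq (by linarith)

lemma ae_existsUnique [Nonempty ι] (φ : ι → ℝ) : ∀ᵐ q ∂μ, ∃! i, q ∈ laguerreCell c φ i := by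
  filter_upwards [hc.ae_ne φ] with q hq
  obtain ⟨i, hi⟩ := exists_mem_laguerreCell c φ q
  refine ⟨i, hi, fun j hj => ?_⟩
  by_contra hij
  exact hq j i hij (le_antisymm (hj i) (hi j))

lemma ae_strict (φ : ι → ℝ) :
    ∀ᵐ q ∂μ, ∀ i, q ∈ laguerreCell c φ i → ∀ j, j ≠ i → c i q - φ i < c j q - φ j := by
  filter_upwards [hc.ae_ne φ] with q hq i hi j hj
  exact lt_of_le_of_ne (hi j) (hq i j hj.symm)

omit [Fintype ι] in
lemma aedisjoint (φ : ι → ℝ) (s : Set ι) :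
    s.Pairwise (Function.onFun (AEDisjoint μ) (laguerreCell c φ)) := by
  intro i _ j _ hij
  refine measure_mono_null (fun q hq => ?_) (hc.null_tie i j hij (φ i - φ j))
  have h1 := hq.1 j
  have h2 := hq.2 i
  simp only [Set.mem_ofPred_eq]
  linarith

lemma measurable_envelope (φ : ι → ℝ) : Measurable (envelope c φ) :=
  Measurable.iSup fun i => (hc.measurable i).const_sub (φ i)

lemma exists_strict_of_pos {φ : ι → ℝ} {i : ι} (h : 0 < μ.real (laguerreCell c φ i)) :
    ∃ q, ∀ j, j ≠ i → c i q - φ i < c j q - φ j := by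
  by_contra! hne
  have : ∀ᵐ q ∂μ, q ∉ laguerreCell c φ i := by
    filter_upwards [hc.ae_strict φ] with q hq hi
    obtain ⟨j, hj, hle⟩ := hne q
    exact absurd (hq i hi j hj) (not_lt.2 hle)
  rw [Measure.real, measure_eq_zero_iff_ae_notMem.2 this] at h
  simp at h

variable [IsProbabilityMeasure μ]

omit [Fintype ι] in
lemma integrable_cost (i : ι) : Integrable (c i) μ := by
  obtain ⟨C, hC⟩ := hc.bounded
  exact .of_bound (hc.measurable i).aestronglyMeasurable C (.of_forall (hC i))

lemma integrable_envelope [Nonempty ι] (φ : ι → ℝ) : Integrable (envelope c φ) μ := by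
  obtain ⟨C, hC⟩ := hc.bounded
  refine .of_bound (hc.measurable_envelope φ).aestronglyMeasurable (C + ∑ i, |φ i|)
    (.of_forall fun q => ?_)
  obtain ⟨i, hi⟩ := exists_mem_laguerreCell c φ q
  rw [envelope_eq_of_mem hi, Real.norm_eq_abs]
  have h1 := Finset.single_le_sum (f := fun i => |φ i|) (fun i _ => abs_nonneg _)
    (Finset.mem_univ i)
  have h2 := abs_sub (φ i) (c i q)
  linarith [hC i q]

lemma sum_measure_cell [Nonempty ι] (φ : ι → ℝ) : ∑ i, μ.real (laguerreCell c φ i) = 1 := by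
  rw [← measureReal_biUnion_finset₀ (hc.aedisjoint φ _)
    fun i _ => (hc.measurableSet_cell φ i).nullMeasurableSet]
  have : (⋃ i ∈ Finset.univ, laguerreCell c φ i) = Set.univ :=
    Set.eq_univ_of_forall fun q => by simpa using exists_mem_laguerreCell c φ q
  rw [this]
  simp

/-- The masses of the cells depend continuously on the heights: at a point without ties the index
of its cell is locally constant in the heights. -/
lemma continuous_measure_cell (i : ι) : Continuous fun φ => μ.real (laguerreCell c φ i) := by
  classical
  have key : (fun φ => μ.real (laguerreCell c φ i)) =
      fun φ => ∫ q, (laguerreCell c φ i).indicator (1 : M → ℝ) q ∂μ := by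
    ext φ
    rw [integral_indicator_one (hc.measurableSet_cell φ i)]
  rw [key, continuous_iff_continuousAt]
  intro φ
  refine continuousAt_of_dominated (bound := fun _ => 1) (.of_forall fun φ =>
    (measurable_one.indicator (hc.measurableSet_cell φ i)).aestronglyMeasurable)
    (.of_forall fun φ => .of_forall fun q => ?_) (integrable_const 1) ?_
  · refine (norm_indicator_le_norm_self _ _).trans (by simp)
  · filter_upwards [hc.ae_ne φ] with q hq
    have hcont : ∀ j, Continuous fun ψ : ι → ℝ => c j q - ψ j := fun j => by fun_prop
    by_cases hi : q ∈ laguerreCell c φ i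
    · have : ∀ᶠ ψ in 𝓝 φ, q ∈ laguerreCell c ψ i := by
        refine eventually_all.2 fun j => ?_
        by_cases hj : i = j
        · exact .of_forall fun ψ => by rw [hj]
        · have := (hcont i).continuousAt.eventually_lt (hcont j).continuousAt
            (lt_of_le_of_ne (hi j) (hq i j hj))
          exact this.mono fun ψ h => h.le
      refine (continuousAt_const (y := (1 : ℝ))).congr ?_
      filter_upwards [this] with ψ hψ
      simp [hψ]
    · obtain ⟨j, hj⟩ : ∃ j, c j q - φ j < c i q - φ i := by
        simpa only [laguerreCell, Set.mem_ofPred_eq, not_forall, not_le] using hi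
      refine (continuousAt_const (y := (0 : ℝ))).congr ?_
      filter_upwards [(hcont j).continuousAt.eventually_lt (hcont i).continuousAt hj] with ψ hψ
      have : q ∉ laguerreCell c ψ i := fun h => absurd (h j) (not_le.2 hψ)
      simp [this]

lemma continuous_massForm : Continuous (massForm μ c) :=
  continuous_finsetSum _ fun i _ => (hc.continuous_measure_cell i).smul continuous_const

/-- The masses of the cells form a subgradient of the potential. -/
lemma potential_add_massForm_le [Nonempty ι] (φ ψ : ι → ℝ) :
    potential μ c φ + massForm μ c φ (ψ - φ) ≤ potential μ c ψ := by
  have hint : ∀ i, Integrable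
      (fun q => (laguerreCell c φ i).indicator (fun _ => ψ i - φ i) q) μ :=
    fun i => (integrable_const _).indicator (hc.measurableSet_cell φ i)
  have hsum : massForm μ c φ (ψ - φ) =
      ∫ q, ∑ i, (laguerreCell c φ i).indicator (fun _ => ψ i - φ i) q ∂μ := by
    rw [massForm_apply, integral_finsetSum _ fun i _ => hint i]
    refine Finset.sum_congr rfl fun i _ => ?_
    rw [integral_indicator_const _ (hc.measurableSet_cell φ i)]
    simp
  rw [hsum, potential, potential,
    ← integral_add (hc.integrable_envelope φ) (integrable_finsetSum _ fun i _ => hint i)]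
  refine integral_mono_ae ((hc.integrable_envelope φ).add
    (integrable_finsetSum _ fun i _ => hint i)) (hc.integrable_envelope ψ) ?_
  filter_upwards [hc.ae_existsUnique φ] with q ⟨i, hi, huniq⟩
  rw [Finset.sum_eq_single i (fun j _ hj => Set.indicator_of_notMem
    (fun h => hj (huniq j h)) _) (by simp), Set.indicator_of_mem hi, envelope_eq_of_mem hi]
  linarith [le_envelope c ψ q i]

lemma hasFDerivAt_potential [Nonempty ι] (φ : ι → ℝ) :
    HasFDerivAt (potential μ c) (massForm μ c φ) φ := by
  rw [hasFDerivAt_iff_isLittleO_nhds_zero, Asymptotics.isLittleO_iff]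
  intro ε hε
  have hcont : Tendsto (fun h => massForm μ c (φ + h)) (𝓝 0) (𝓝 (massForm μ c φ)) := by
    have : Continuous fun h => massForm μ c (φ + h) :=
      hc.continuous_massForm.comp (continuous_const.add continuous_id)
    simpa using this.tendsto 0
  filter_upwards [Metric.tendsto_nhds.1 hcont ε hε] with h hh
  rw [dist_eq_norm] at hh
  -- the subgradient inequalities at `φ` and at `φ + h` enclose the increment
  have h1 := hc.potential_add_massForm_le φ (φ + h)
  have h2 := hc.potential_add_massForm_le (φ + h) φ
  simp only [add_sub_cancel_left, sub_add_cancel_left, map_neg] at h1 h2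
  have h3 := (massForm μ c (φ + h) - massForm μ c φ).le_opNorm h
  rw [_root_.sub_apply, Real.norm_eq_abs] at h3
  have h4 := mul_le_mul_of_nonneg_right hh.le (norm_nonneg h)
  rw [Real.norm_eq_abs, abs_le]
  have h5 := le_abs_self (massForm μ c (φ + h) h - massForm μ c φ h)
  have h6 : 0 ≤ ε * ‖h‖ := by positivity
  constructor <;> linarith

lemma convexOn_potential [Nonempty ι] : ConvexOn ℝ Set.univ (potential μ c) := by
  refine ⟨convex_univ, fun φ _ ψ _ a b ha hb hab => ?_⟩
  set χ := a • φ + b • ψ with hχ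
  have h1 := mul_le_mul_of_nonneg_left (hc.potential_add_massForm_le χ φ) ha
  have h2 := mul_le_mul_of_nonneg_left (hc.potential_add_massForm_le χ ψ) hb
  have h3 : a * massForm μ c χ (φ - χ) + b * massForm μ c χ (ψ - χ) = 0 := by
    rw [← smul_eq_mul, ← smul_eq_mul, ← map_smul, ← map_smul, ← map_add]
    have : a • (φ - χ) + b • (ψ - χ) = 0 := by
      have : a • (φ - χ) + b • (ψ - χ) = χ - (a + b) • χ := by rw [hχ]; module
      rw [this, hab, one_smul, sub_self]
    rw [this, map_zero]
  have h4 : a * potential μ c χ + b * potential μ c χ = potential μ c χ := by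
    rw [← add_mul, hab, one_mul]
  simp only [smul_eq_mul]
  linarith

lemma potential_add_const [Nonempty ι] (φ : ι → ℝ) (t : ℝ) :
    potential μ c (fun i => φ i + t) = potential μ c φ + t := by
  have h1 := hc.potential_add_massForm_le φ (fun i => φ i + t)
  have h2 := hc.potential_add_massForm_le (fun i => φ i + t) φ
  simp only [massForm_apply, Pi.sub_apply, add_sub_cancel_left, sub_add_cancel_left,
    ← Finset.sum_mul, hc.sum_measure_cell] at h1 h2
  linarith

/-- Heights whose cells have prescribed positive masses exist: minimize the convex function
`P(φ) - ∑ φ i w i`, which is coercive modulo constants. -/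
theorem exists_heights [Nonempty ι] {w : ι → ℝ} (hw : ∀ i, 0 < w i) (hsum : ∑ i, w i = 1) :
    ∃ φ : ι → ℝ, ∀ i, μ.real (laguerreCell c φ i) = w i := by
  classical
  obtain ⟨C, hC⟩ := hc.bounded
  have hC0 : 0 ≤ C := by
    obtain ⟨q⟩ : Nonempty M := nonempty_of_isProbabilityMeasure μ
    exact (abs_nonneg _).trans (hC (Classical.arbitrary ι) q)
  let F : (ι → ℝ) → ℝ := fun φ => potential μ c φ - ∑ i, φ i * w i
  let L : (ι → ℝ) →L[ℝ] ℝ :=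
    ∑ i, w i • ContinuousLinearMap.proj (R := ℝ) (φ := fun _ : ι => ℝ) i
  have hL : ∀ φ, L φ = ∑ i, φ i * w i := fun φ => by simp [L, mul_comm]
  have hF : ∀ φ, HasFDerivAt F (massForm μ c φ - L) φ := fun φ => by
    have := (hc.hasFDerivAt_potential φ).sub L.hasFDerivAt
    refine this.congr_of_eventuallyEq (.of_forall fun ψ => ?_)
    simp [F, hL]
  have hFcont : Continuous F := continuous_iff_continuousAt.2 fun φ => (hF φ).continuousAt
  -- outside the box `[-R, 0]^ι`, a vector of heights with maximum `0` has larger energy than `0`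
  let R : ℝ := ∑ i, 2 * C / w i
  have hRi : ∀ i, 2 * C ≤ R * w i := fun i => by
    have h := Finset.single_le_sum (f := fun i => 2 * C / w i)
      (fun i _ => div_nonneg (by linarith) (hw i).le) (Finset.mem_univ i)
    exact (div_le_iff₀ (hw i)).1 h
  have hR : 0 ≤ R := Finset.sum_nonneg fun i _ => div_nonneg (by linarith) (hw i).le
  have hcompact := isCompact_Icc (a := fun _ : ι => -R) (b := fun _ : ι => (0 : ℝ))
  obtain ⟨φ, -, hφ⟩ := hcompact.exists_isMinOn
    ⟨0, fun _ => by simpa using hR, fun _ => le_rfl⟩ hFcont.continuousOn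
  have hzero : F φ ≤ C := by
    have h0 : F φ ≤ F 0 := hφ ⟨fun _ => by simpa using hR, fun _ => le_rfl⟩
    refine h0.trans ?_
    have : potential μ c 0 ≤ ∫ _, C ∂μ :=
      integral_mono (hc.integrable_envelope 0) (integrable_const C) fun q => envelope_le fun i => by
        have := neg_le_of_abs_le (hC i q)
        simp only [Pi.zero_apply]
        linarith
    simpa [F] using this
  have hmin : ∀ ψ, F φ ≤ F ψ := fun ψ => by
    obtain ⟨m, -, hm⟩ := Finset.exists_max_image Finset.univ ψ Finset.univ_nonempty
    let χ : ι → ℝ := fun i => ψ i + -ψ m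
    have hχ : ∀ i, χ i ≤ 0 := fun i => by
      have := hm i (Finset.mem_univ i)
      simp only [χ]; linarith
    have hFχ : F χ = F ψ := by
      simp only [F, χ, hc.potential_add_const, add_mul, Finset.sum_add_distrib, ← Finset.mul_sum,
        hsum]
      ring
    rw [← hFχ]
    by_cases hbox : ∀ i, -R ≤ χ i
    · exact hφ ⟨hbox, hχ⟩
    · push Not at hbox
      obtain ⟨i, hi⟩ := hbox
      have h1 : -C ≤ potential μ c χ := by
        have : ∫ _, -C ∂μ ≤ potential μ c χ :=
          integral_mono (integrable_const _) (hc.integrable_envelope χ) fun q => by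
            have h1 := le_envelope c χ q m
            have h2 := le_of_abs_le (hC m q)
            have h3 : χ m = 0 := by simp [χ]
            rw [h3] at h1
            show -C ≤ _
            linarith
        simpa using this
      have h2 : -(∑ j, χ j * w j) ≥ R * w i := by
        rw [← Finset.sum_neg_distrib]
        have h := Finset.single_le_sum (f := fun j => -(χ j * w j))
          (fun j _ => by nlinarith [hχ j, hw j]) (Finset.mem_univ i)
        refine le_trans ?_ h
        nlinarith [hw i]
      have h3 := hRi i
      simp only [F] at hzero ⊢
      linarith
  refine ⟨φ, fun i => ?_⟩
  have hloc : IsLocalMin F φ := Filter.Eventually.of_forall hmin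
  have h0 := hloc.hasFDerivAt_eq_zero (hF φ)
  have h1 := congrArg (fun l : (ι → ℝ) →L[ℝ] ℝ => l (Pi.single i 1)) h0
  simp only [_root_.sub_apply, massForm_apply, hL] at h1
  simp [Pi.single_apply] at h1
  linarith

/-- On a connected space, if all nonempty open sets have positive mass and the costs are continuous,
the heights are determined by the masses of the cells up to a constant: if `ψ - φ` is not constant,
the union of the cells of the indices where it is maximal strictly grows from `φ` to `ψ`. -/
theorem heights_unique [TopologicalSpace M] [PreconnectedSpace M]
    [μ.IsOpenPosMeasure] (hcont : ∀ i, Continuous (c i)) {w φ ψ : ι → ℝ} (hw : ∀ i, 0 < w i)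
    (hφ : ∀ i, μ.real (laguerreCell c φ i) = w i) (hψ : ∀ i, μ.real (laguerreCell c ψ i) = w i) :
    ∃ a, ∀ i, ψ i = φ i + a := by
  classical
  rcases isEmpty_or_nonempty ι with hι | hι
  · exact ⟨0, fun i => hι.elim i⟩
  obtain ⟨m, -, hm⟩ := Finset.exists_max_image Finset.univ (fun i => ψ i - φ i)
    Finset.univ_nonempty
  set a := ψ m - φ m with ha
  refine ⟨a, ?_⟩
  by_contra! hne
  obtain ⟨n, hn⟩ := hne
  let I : Finset ι := {i | ψ i - φ i = a}
  have hmI : m ∈ I := by simp [I, ha]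
  have hnI : n ∉ I := by
    simp only [I, Finset.mem_filter, Finset.mem_univ, true_and]
    intro h; exact hn (by linarith)
  have hlt : ∀ j ∉ I, ψ j - φ j < a := fun j hj => lt_of_le_of_ne (hm j (Finset.mem_univ j))
    (by simpa [I] using hj)
  -- `A ⊆ B ⊆ A'` with `A` closed and `B` open: by connectedness `B \ A` is open and nonempty, while
  -- `A` and `A'` have the same mass
  let A : Set M := ⋃ i ∈ I, laguerreCell c φ i
  let A' : Set M := ⋃ i ∈ I, laguerreCell c ψ i
  let B : Set M := ⋃ i ∈ I, ⋂ j ∈ Finset.univ.filter (· ∉ I),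
    {q | c i q - φ i < c j q - φ j + (a - (ψ j - φ j))}
  have hmass : ∀ χ : ι → ℝ, (∀ i, μ.real (laguerreCell c χ i) = w i) →
      μ.real (⋃ i ∈ I, laguerreCell c χ i) = ∑ i ∈ I, w i := fun χ hχ => by
    rw [measureReal_biUnion_finset₀ (hc.aedisjoint χ _)
      fun i _ => (hc.measurableSet_cell χ i).nullMeasurableSet]
    exact Finset.sum_congr rfl fun i _ => hχ i
  have hAB : A ⊆ B := fun q hq => by
    obtain ⟨i, hi, h⟩ := (mem_biUnion_laguerreCell_iff c φ I q).1 hq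
    simp only [B, Set.mem_iUnion, Set.mem_iInter, Set.mem_ofPred_eq, Finset.mem_filter,
      Finset.mem_univ, true_and]
    exact ⟨i, hi, fun j hj => by linarith [h j hj, hlt j hj]⟩
  have hBA : B ⊆ A' := fun q hq => by
    refine (mem_biUnion_laguerreCell_iff c ψ I q).2 ?_
    simp only [B, Set.mem_iUnion, Set.mem_iInter, Set.mem_ofPred_eq, Finset.mem_filter,
      Finset.mem_univ, true_and] at hq
    obtain ⟨i, hi, h⟩ := hq
    refine ⟨i, hi, fun j hj => ?_⟩
    have hia : ψ i - φ i = a := by simpa [I] using hi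
    linarith [h j hj]
  have hA : IsClosed A := by
    refine isClosed_biUnion_finset fun i _ => ?_
    have : laguerreCell c φ i = ⋂ j, {q | c i q - φ i ≤ c j q - φ j} := by
      ext q; simp [laguerreCell]
    rw [this]
    exact isClosed_iInter fun j => isClosed_le ((hcont i).sub continuous_const)
      ((hcont j).sub continuous_const)
  have hB : IsOpen B := by
    refine isOpen_biUnion fun i _ => isOpen_biInter_finset fun j _ => ?_
    exact isOpen_lt ((hcont i).sub continuous_const)
      (((hcont j).sub continuous_const).add continuous_const)
  have hdiff : (B \ A).Nonempty := by
    rw [Set.nonempty_iff_ne_empty]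
    intro he
    have hEq : A = B := hAB.antisymm (Set.sdiff_eq_empty.1 he)
    have hclopen : IsClopen A := ⟨hA, hEq ▸ hB⟩
    have hAm := hmass φ hφ
    rcases isClopen_iff.1 hclopen with h | h
    · have : 0 < ∑ i ∈ I, w i := Finset.sum_pos (fun i _ => hw i) ⟨m, hmI⟩
      change μ.real A = _ at hAm
      rw [h] at hAm
      simp at hAm
      linarith
    · change μ.real A = _ at hAm
      have h1 := hc.sum_measure_cell φ
      simp only [hφ] at h1
      rw [h] at hAm
      rw [probReal_univ] at hAm
      have : ∑ i ∈ I, w i < ∑ i, w i := Finset.sum_lt_sum_of_subset (Finset.subset_univ _)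
        (Finset.mem_univ n) hnI (hw n) fun j _ _ => (hw j).le
      linarith
  have hpos : 0 < μ (B \ A) := (hB.sdiff hA).measure_pos μ hdiff
  have hAmeas : MeasurableSet A := Finset.measurableSet_biUnion _
    fun i _ => hc.measurableSet_cell φ i
  have h1 : μ.real (A ∪ B \ A) = μ.real A + μ.real (B \ A) :=
    measureReal_union' Set.disjoint_sdiff_right hAmeas (measure_ne_top _ _) (measure_ne_top _ _)
  have h2 : μ.real (A ∪ B \ A) ≤ μ.real A' :=
    measureReal_mono (Set.union_subset (hAB.trans hBA) (Set.sdiff_subset.trans hBA))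
      (measure_ne_top _ _)
  have h3 : 0 < μ.real (B \ A) := ENNReal.toReal_pos hpos.ne' (measure_ne_top _ _)
  have h4 : μ.real A = μ.real A' := (hmass φ hφ).trans (hmass ψ hψ).symm
  linarith

end IsGenericCost

end Measure

end SemidiscreteOT

/-- The fundamental theorem of calculus for a continuous differential form with a potential. -/
lemma curveIntegral_eq_sub_of_hasFDerivAt {E : Type*} [NormedAddCommGroup E] [NormedSpace ℝ E]
    {P : E → ℝ} {ω : E → E →L[ℝ] ℝ} (hω : Continuous ω) (hP : ∀ z, HasFDerivAt P (ω z) z)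
    {a b : E} (γ : Path a b) (hγ : ContDiffOn ℝ 1 γ.extend (Set.Icc 0 1)) :
    CurveIntegrable ω γ ∧ curveIntegral ω γ = P b - P a := by
  have hint : CurveIntegrable ω γ :=
    (hω.continuousOn (s := Set.univ)).curveIntegrable_of_contDiffOn hγ fun _ => Set.mem_univ _
  refine ⟨hint, ?_⟩
  have hPc : Continuous P := continuous_iff_continuousAt.2 fun z => (hP z).continuousAt
  rw [curveIntegral_def, intervalIntegral.integral_eq_sub_of_hasDerivAt_of_le
    (f := fun t => P (γ.extend t)) zero_le_one (hPc.comp γ.continuous_extend).continuousOn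
    (fun t ht => ?_) hint]
  · simp
  · rw [curveIntegralFun_def]
    have hd : DifferentiableWithinAt ℝ γ.extend (Set.Icc 0 1) t :=
      hγ.differentiableOn one_ne_zero t (Set.Ioo_subset_Icc_self ht)
    exact (hP _).comp_hasDerivAt t
      (hd.hasDerivWithinAt.hasDerivAt (Icc_mem_nhds ht.1 ht.2))

namespace SemidiscreteOT

namespace IsGenericCost

variable {M ι : Type*} [Fintype ι] [MeasurableSpace M] {μ : Measure M} {c : ι → M → ℝ}
  (hc : IsGenericCost μ c)
include hc

/-- There is a measurable map sending almost every point of the `i`-th cell to `p i`. -/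
lemma exists_measurable_selection [Nonempty ι] (φ : ι → ℝ) (p : ι → M) :
    ∃ T : M → M, Measurable T ∧ ∀ᵐ q ∂μ, ∀ i, q ∈ laguerreCell c φ i → T q = p i := by
  let V : ι → Set M := fun i => ⋂ j, ⋂ (_ : j ≠ i), {q | c i q - φ i < c j q - φ j}
  have hV : ∀ i, MeasurableSet (V i) := fun i => .iInter fun j => .iInter fun _ =>
    measurableSet_lt ((hc.measurable i).sub_const _) ((hc.measurable j).sub_const _)
  have hmem : ∀ i q, q ∈ V i ↔ ∀ j, j ≠ i → c i q - φ i < c j q - φ j := fun i q => by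
    simp [V]
  obtain ⟨T, hT, hTV⟩ := exists_measurable_piecewise V hV (fun i _ => p i)
    (fun i => measurable_const) fun i j hij q hq => by
      have h1 := (hmem i q).1 hq.1 j hij.symm
      have h2 := (hmem j q).1 hq.2 i hij
      exact absurd h1 (not_lt.2 h2.le)
  refine ⟨T, hT, ?_⟩
  filter_upwards [hc.ae_strict φ] with q hq i hi
  exact hTV i ((hmem i q).2 (hq i hi))

variable [IsProbabilityMeasure μ] {w φ : ι → ℝ} {p : ι → M}

lemma measurePreserving_of_eq_on_cells [Nonempty ι] (hφ : ∀ i, μ.real (laguerreCell c φ i) = w i)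
    {T : M → M} (hT : Measurable T)
    (hTp : ∀ᵐ q ∂μ, ∀ i, q ∈ laguerreCell c φ i → T q = p i) :
    MeasurePreserving T μ (∑ i, ENNReal.ofReal (w i) • Measure.dirac (p i)) := by
  classical
  refine ⟨hT, Measure.ext fun s hs => ?_⟩
  have hae : T ⁻¹' s =ᵐ[μ] ⋃ i ∈ Finset.univ.filter (fun i => p i ∈ s), laguerreCell c φ i := by
    filter_upwards [hTp, hc.ae_existsUnique φ] with q hq ⟨i, hi, huniq⟩
    refine propext ⟨fun h => ?_, fun h => ?_⟩
    · have h' : T q ∈ s := h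
      rw [hq i hi] at h'
      exact Set.mem_biUnion (show i ∈ Finset.univ.filter (fun i => p i ∈ s) by simp [h']) hi
    · obtain ⟨j, hj, hqj⟩ := Set.mem_iUnion₂.1 h
      change T q ∈ s
      rw [hq j hqj]
      simpa using hj
  rw [Measure.map_apply hT hs, measure_congr hae, measure_biUnion_finset₀ (hc.aedisjoint φ _)
    fun i _ => (hc.measurableSet_cell φ i).nullMeasurableSet]
  simp only [Measure.coe_finsetSum, Finset.sum_apply, Measure.smul_apply,
    Measure.dirac_apply' _ hs, smul_eq_mul, Finset.sum_filter]
  refine Finset.sum_congr rfl fun i _ => ?_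
  by_cases hi : p i ∈ s <;> simp [hi, ← hφ i]

variable {cost : M → M → ℝ} (hcost : ∀ i q, cost q (p i) = c i q)
  (hp : Function.Injective p) (hps : ∀ i, MeasurableSet {p i})
include hcost hp hps

/-- A transport map `S` takes its values in the points `p i` almost everywhere and has integrable
cost; the height `h q` of the target of `q` is integrable, with an integral that does not depend on
`S`. -/
lemma integrable_cost_and_integral_height (hw : ∀ i, 0 ≤ w i) (φ : ι → ℝ) {S : M → M}
    (hS : MeasurePreserving S μ (∑ i, ENNReal.ofReal (w i) • Measure.dirac (p i))) :
    (∀ᵐ q ∂μ, ∃ i, S q = p i) ∧ Integrable (fun q => cost q (S q)) μ ∧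
    ∃ h : M → ℝ, (∀ q i, S q = p i → h q = φ i) ∧ Integrable h μ ∧
      ∫ q, h q ∂μ = ∑ i, φ i * w i := by
  classical
  set ν : Measure M := ∑ i, ENNReal.ofReal (w i) • Measure.dirac (p i) with hν
  have hpre : ∀ i, MeasurableSet (S ⁻¹' {p i}) := fun i => hS.measurable (hps i)
  have hmass : ∀ i, μ.real (S ⁻¹' {p i}) = w i := fun i => by
    rw [Measure.real, hS.measure_preimage (hps i).nullMeasurableSet, hν]
    simp only [Measure.coe_finsetSum, Finset.sum_apply, Measure.smul_apply,
      Measure.dirac_apply' _ (hps i), smul_eq_mul]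
    rw [Finset.sum_eq_single i (fun j _ hj => by simp [hp.ne hj]) (by simp)]
    simp [hw i]
  have hrange : MeasurableSet (Set.range p) := by
    rw [← Set.iUnion_singleton_eq_range]
    exact .iUnion hps
  have hae : ∀ᵐ q ∂μ, ∃ i, S q = p i := by
    have h0 : ν (Set.range p)ᶜ = 0 := by
      simp [hν, Measure.dirac_apply' _ hrange.compl]
    rw [← hS.measure_preimage hrange.compl.nullMeasurableSet] at h0
    rw [ae_iff]
    convert! h0 using 2
    ext q
    simp [eq_comm]
  have hsum : ∀ (g : ι → M → ℝ) (q : M) (i : ι), S q = p i →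
      ∑ j, (S ⁻¹' {p j}).indicator (g j) q = g i q := fun g q i hi => by
    rw [Finset.sum_eq_single i (fun j _ hj => Set.indicator_of_notMem (by
      simp only [Set.mem_preimage, Set.mem_singleton_iff, hi]
      exact fun h => hj (hp h).symm) _) (by simp), Set.indicator_of_mem (by simpa using hi)]
  refine ⟨hae, ?_, fun q => ∑ i, (S ⁻¹' {p i}).indicator (fun _ => φ i) q,
    fun q i hi => hsum (fun i _ => φ i) q i hi, ?_, ?_⟩
  · refine (integrable_finsetSum Finset.univ fun i _ =>
      (hc.integrable_cost i).indicator (hpre i)).congr ?_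
    filter_upwards [hae] with q ⟨i, hi⟩
    rw [hsum _ q i hi, hi, hcost]
  · exact integrable_finsetSum _ fun i _ => (integrable_const _).indicator (hpre i)
  · rw [integral_finsetSum _ fun i _ => (integrable_const _).indicator (hpre i)]
    refine Finset.sum_congr rfl fun i _ => ?_
    rw [integral_indicator_const _ (hpre i), hmass, smul_eq_mul, mul_comm]

/-- Kantorovich duality for the map given by the Laguerre cells: sending the `i`-th cell to `p i`
minimizes the cost minus the height of the target pointwise, and all transport maps have the same
integrated height of the target. -/
theorem integral_cost_le [Nonempty ι] (hw : ∀ i, 0 ≤ w i)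
    (hφ : ∀ i, μ.real (laguerreCell c φ i) = w i) {T S : M → M} (hT : Measurable T)
    (hTp : ∀ᵐ q ∂μ, ∀ i, q ∈ laguerreCell c φ i → T q = p i)
    (hS : MeasurePreserving S μ (∑ i, ENNReal.ofReal (w i) • Measure.dirac (p i))) :
    ∫ q, cost q (T q) ∂μ ≤ ∫ q, cost q (S q) ∂μ := by
  obtain ⟨-, hTi, h, hh, hhi, hhint⟩ := hc.integrable_cost_and_integral_height hcost hp hps hw φ
    (hc.measurePreserving_of_eq_on_cells hφ hT hTp)
  obtain ⟨hSae, hSi, g, hg, hgi, hgint⟩ :=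
    hc.integrable_cost_and_integral_height hcost hp hps hw φ hS
  have h1 : ∫ q, (cost q (T q) - h q) ∂μ ≤ ∫ q, (cost q (S q) - g q) ∂μ := by
    refine integral_mono_ae (hTi.sub hhi) (hSi.sub hgi) ?_
    filter_upwards [hSae, hTp, hc.ae_existsUnique φ] with q ⟨j, hj⟩ hq ⟨i, hi, _⟩
    have hTq := hq i hi
    simp only [hh q i hTq, hg q j hj]
    rw [hTq, hj, hcost, hcost]
    exact hi j
  rw [integral_sub hTi hhi, integral_sub hSi hgi, hhint, hgint] at h1
  linarith

end IsGenericCost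

end SemidiscreteOT

/-! ### Lorentzian geometry -/

namespace HypOT

variable {m : ℕ}

lemma lorentz_comm (x y : Fin (m + 1) → ℝ) : lorentz x y = lorentz y x := by
  simp only [lorentz, mul_comm]

lemma lorentz_add_left (x y z : Fin (m + 1) → ℝ) :
    lorentz (x + y) z = lorentz x z + lorentz y z := by
  simp only [lorentz, Pi.add_apply, add_mul, Finset.sum_add_distrib]
  ring

lemma lorentz_smul_left (a : ℝ) (x z : Fin (m + 1) → ℝ) :
    lorentz (a • x) z = a * lorentz x z := by
  simp only [lorentz, Pi.smul_apply, smul_eq_mul, mul_sub, Finset.mul_sum, mul_assoc]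

lemma lorentz_sub_left (x y z : Fin (m + 1) → ℝ) :
    lorentz (x - y) z = lorentz x z - lorentz y z := by
  simp only [lorentz, Pi.sub_apply, sub_mul, Finset.sum_sub_distrib]
  ring

lemma lorentz_add_right (x y z : Fin (m + 1) → ℝ) :
    lorentz x (y + z) = lorentz x y + lorentz x z := by
  rw [lorentz_comm, lorentz_add_left, lorentz_comm y, lorentz_comm z]

lemma lorentz_smul_right (a : ℝ) (x z : Fin (m + 1) → ℝ) :
    lorentz x (a • z) = a * lorentz x z := by
  rw [lorentz_comm, lorentz_smul_left, lorentz_comm z]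

lemma lorentz_sub_right (x y z : Fin (m + 1) → ℝ) :
    lorentz x (y - z) = lorentz x y - lorentz x z := by
  rw [lorentz_comm, lorentz_sub_left, lorentz_comm y, lorentz_comm z]

@[fun_prop]
lemma continuous_lorentz {X : Type*} [TopologicalSpace X] {f g : X → Fin (m + 1) → ℝ}
    (hf : Continuous f) (hg : Continuous g) : Continuous fun t => lorentz (f t) (g t) := by
  unfold lorentz
  fun_prop

/-- The Euclidean norm of the space part is less than the time coordinate on the future cone. -/
lemma sqrt_sum_lt_of_mem_futureCone {u : Fin (m + 1) → ℝ} (hu : u ∈ futureCone m) :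
    √(∑ i : Fin m, u i.castSucc ^ 2) < u (Fin.last m) := by
  rw [Real.sqrt_lt' hu.2]
  have := hu.1
  simp only [lorentz, ← pow_two] at this
  linarith

/-- Two future vectors have negative product; quantitatively, a bound on their product bounds the
time coordinate of one in terms of the other. -/
lemma last_mul_le_of_mem_futureCone {u v : Fin (m + 1) → ℝ} (hu : u ∈ futureCone m)
    (hv : v ∈ futureCone m) :
    u (Fin.last m) * -lorentz v v ≤ 2 * v (Fin.last m) * -lorentz u v := by
  set U := √(∑ i : Fin m, u i.castSucc ^ 2) with hU
  set V := √(∑ i : Fin m, v i.castSucc ^ 2) with hV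
  have hUlt : U < u (Fin.last m) := sqrt_sum_lt_of_mem_futureCone hu
  have hVlt : V < v (Fin.last m) := sqrt_sum_lt_of_mem_futureCone hv
  have hU0 : 0 ≤ U := Real.sqrt_nonneg _
  have hV0 : 0 ≤ V := Real.sqrt_nonneg _
  have hcs : ∑ i : Fin m, u i.castSucc * v i.castSucc ≤ U * V :=
    Real.sum_mul_le_sqrt_mul_sqrt _ _ _
  have hVV : V ^ 2 = ∑ i : Fin m, v i.castSucc ^ 2 :=
    Real.sq_sqrt (Finset.sum_nonneg fun _ _ => sq_nonneg _)
  have hvv : -lorentz v v = (v (Fin.last m) - V) * (v (Fin.last m) + V) := by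
    simp only [lorentz, ← pow_two, ← hVV]
    ring
  have huv : u (Fin.last m) * (v (Fin.last m) - V) ≤ -lorentz u v := by
    simp only [lorentz]
    nlinarith
  rw [hvv]
  have h1 : u (Fin.last m) * (v (Fin.last m) - V) * (v (Fin.last m) + V) ≤
      u (Fin.last m) * (v (Fin.last m) - V) * (2 * v (Fin.last m)) :=
    mul_le_mul_of_nonneg_left (by linarith) (mul_nonneg hu.2.le (by linarith))
  have h2 := mul_le_mul_of_nonneg_right huv (by linarith [hv.2] : 0 ≤ 2 * v (Fin.last m))
  linarith

lemma neg_lorentz_pos {u v : Fin (m + 1) → ℝ} (hu : u ∈ futureCone m) (hv : v ∈ futureCone m) :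
    0 < -lorentz u v := by
  have h := last_mul_le_of_mem_futureCone hu hv
  have h1 : 0 < u (Fin.last m) * -lorentz v v := mul_pos hu.2 (by linarith [hv.1])
  have h2 : 0 < 2 * v (Fin.last m) := by linarith [hv.2]
  exact pos_of_mul_pos_right (h1.trans_le h) h2.le

lemma add_mem_futureCone {u v : Fin (m + 1) → ℝ} (hu : u ∈ futureCone m)
    (hv : v ∈ futureCone m) : u + v ∈ futureCone m := by
  refine ⟨?_, add_pos hu.2 hv.2⟩
  rw [lorentz_add_left, lorentz_add_right, lorentz_add_right, lorentz_comm v u]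
  linarith [hu.1, hv.1, neg_lorentz_pos hu hv]

lemma smul_mem_futureCone {u : Fin (m + 1) → ℝ} (hu : u ∈ futureCone m) {a : ℝ} (ha : 0 < a) :
    a • u ∈ futureCone m := by
  refine ⟨?_, mul_pos ha hu.2⟩
  rw [lorentz_smul_left, lorentz_smul_right]
  have := mul_pos (mul_pos ha ha) (neg_pos.2 hu.1)
  linarith

lemma isOpen_futureCone (m : ℕ) : IsOpen (futureCone m) :=
  (isOpen_lt (continuous_lorentz continuous_id continuous_id) continuous_const).inter
    (isOpen_lt continuous_const (continuous_apply _))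

lemma abs_apply_le_last {u : Fin (m + 1) → ℝ} (hu : u ∈ futureCone m) (i : Fin (m + 1)) :
    |u i| ≤ u (Fin.last m) := by
  refine Fin.lastCases ?_ (fun i => ?_) i
  · rw [abs_of_pos hu.2]
  · refine le_trans ?_ (sqrt_sum_lt_of_mem_futureCone hu).le
    refine Real.abs_le_sqrt ?_
    exact Finset.single_le_sum (f := fun i : Fin m => u i.castSucc ^ 2)
      (fun i _ => sq_nonneg _) (Finset.mem_univ i)

lemma Hyp.mem_futureCone (y : Hyp m) : y.1 ∈ futureCone m :=
  ⟨by rw [y.2.1]; norm_num, y.2.2⟩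

/-- Every future vector is a positive multiple of a point of hyperbolic space. -/
lemma exists_smul_hyp {u : Fin (m + 1) → ℝ} (hu : u ∈ futureCone m) :
    ∃ y : Hyp m, ∃ a : ℝ, 0 < a ∧ y.1 = a • u := by
  have h : 0 < -lorentz u u := neg_pos.2 hu.1
  have hs : 0 < √(-lorentz u u) := Real.sqrt_pos.2 h
  refine ⟨⟨(√(-lorentz u u))⁻¹ • u, ?_, mul_pos (inv_pos.2 hs) hu.2⟩, _, inv_pos.2 hs, rfl⟩
  have hss : √(-lorentz u u) * √(-lorentz u u) = -lorentz u u := Real.mul_self_sqrt h.le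
  rw [lorentz_smul_left, lorentz_smul_right, ← mul_assoc, ← mul_inv, hss, inv_neg, neg_mul,
    inv_mul_cancel₀ hu.1.ne]

/-- The reversed Cauchy–Schwarz inequality on the hyperboloid. -/
lemma one_lt_neg_lorentz {x y : Hyp m} (h : x ≠ y) : 1 < -lorentz x.1 y.1 := by
  obtain ⟨x, hx, hx0⟩ := x
  obtain ⟨y, hy, hy0⟩ := y
  have hne : x ≠ y := fun h' => h (Subtype.ext h')
  set s := x (Fin.last m) with hs
  set t := y (Fin.last m) with ht
  have hX : ∑ i : Fin m, x i.castSucc ^ 2 = s ^ 2 - 1 := by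
    simp only [lorentz, ← pow_two] at hx
    linarith
  have hY : ∑ i : Fin m, y i.castSucc ^ 2 = t ^ 2 - 1 := by
    simp only [lorentz, ← pow_two] at hy
    linarith
  have hcs := Finset.sum_mul_sq_le_sq_mul_sq Finset.univ
    (fun i : Fin m => x i.castSucc) (fun i : Fin m => y i.castSucc)
  rw [hX, hY] at hcs
  set P := ∑ i : Fin m, x i.castSucc * y i.castSucc with hP
  have hs1 : 0 ≤ s ^ 2 - 1 := hX ▸ Finset.sum_nonneg fun _ _ => sq_nonneg _
  have ht1 : 0 ≤ t ^ 2 - 1 := hY ▸ Finset.sum_nonneg fun _ _ => sq_nonneg _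
  have hs1' : 1 ≤ s := by nlinarith
  have ht1' : 1 ≤ t := by nlinarith
  have hst : 1 ≤ s * t := by nlinarith
  change 1 < -(P - s * t)
  by_contra! hcon
  have h0 : s * t - 1 ≤ P := by linarith
  have h1 : (s * t - 1) ^ 2 ≤ P ^ 2 := pow_le_pow_left₀ (by linarith) h0 2
  have hsq : (s - t) ^ 2 ≤ 0 := by nlinarith
  have hst' : s = t := by
    have := pow_eq_zero_iff (two_ne_zero) |>.1 (le_antisymm hsq (sq_nonneg _))
    linarith
  have hdiff : ∑ i : Fin m, (x i.castSucc - y i.castSucc) ^ 2 ≤ 0 := by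
    have : ∑ i : Fin m, (x i.castSucc - y i.castSucc) ^ 2 = (s ^ 2 - 1) - 2 * P + (t ^ 2 - 1) := by
      rw [← hX, ← hY, hP, Finset.mul_sum, ← Finset.sum_sub_distrib, ← Finset.sum_add_distrib]
      exact Finset.sum_congr rfl fun i _ => by ring
    rw [this]
    nlinarith
  have hz := (Finset.sum_eq_zero_iff_of_nonneg (fun i _ => sq_nonneg _)).1
    (le_antisymm hdiff (Finset.sum_nonneg fun i _ => sq_nonneg _))
  refine hne (funext fun i => Fin.lastCases hst' (fun i => ?_) i)
  have := pow_eq_zero_iff (two_ne_zero) |>.1 (hz i (Finset.mem_univ i))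
  linarith

lemma one_le_neg_lorentz (x y : Hyp m) : 1 ≤ -lorentz x.1 y.1 := by
  by_cases h : x = y
  · rw [h, y.2.1, neg_neg]
  · exact (one_lt_neg_lorentz h).le

/-- Locally, points of hyperbolic space are comparable in the order of the future cone with
constants close to `1`, so that the products with all future vectors are comparable, uniformly. -/
lemma eventually_mul_neg_lorentz_le (y₀ : Hyp m) {a : ℝ} (ha : a < 1) :
    ∀ᶠ y in nhds y₀, ∀ z ∈ futureCone m, a * -lorentz z y₀.1 ≤ -lorentz z y.1 ∧
      a * -lorentz z y.1 ≤ -lorentz z y₀.1 := by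
  have hmem : y₀.1 - a • y₀.1 ∈ futureCone m := by
    have : y₀.1 - a • y₀.1 = (1 - a) • y₀.1 := by rw [sub_smul, one_smul]
    rw [this]
    exact smul_mem_futureCone y₀.mem_futureCone (by linarith)
  have h1 : ∀ᶠ y : Hyp m in nhds y₀, y.1 - a • y₀.1 ∈ futureCone m :=
    (continuous_subtype_val.sub continuous_const).continuousAt.eventually
      ((isOpen_futureCone m).mem_nhds hmem)
  have h2 : ∀ᶠ y : Hyp m in nhds y₀, y₀.1 - a • y.1 ∈ futureCone m :=
    (continuous_const.sub (continuous_subtype_val.const_smul a)).continuousAt.eventually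
      ((isOpen_futureCone m).mem_nhds hmem)
  filter_upwards [h1, h2] with y hy1 hy2 z hz
  have e1 := neg_lorentz_pos hz hy1
  have e2 := neg_lorentz_pos hz hy2
  rw [lorentz_sub_right, lorentz_smul_right] at e1 e2
  constructor <;> linarith

lemma hypChart_surjective (m : ℕ) : Function.Surjective (hypChart m) := by
  intro y
  refine ⟨fun i => y.1 i.castSucc, Subtype.ext (funext fun i => ?_)⟩
  refine Fin.lastCases ?_ (fun i => ?_) i
  · have h := y.2.1
    simp only [lorentz, ← pow_two] at h
    simp only [hypChart, graphMap, Fin.snoc_last]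
    rw [show 1 + ∑ i : Fin m, y.1 i.castSucc ^ 2 = y.1 (Fin.last m) ^ 2 by linarith]
    exact Real.sqrt_sq y.2.2.le
  · simp [hypChart, graphMap]

lemma continuous_graphMap (m : ℕ) : Continuous (graphMap m) := by
  refine continuous_pi fun i => Fin.lastCases ?_ (fun i => ?_) i
  · simp only [graphMap, Fin.snoc_last]
    fun_prop
  · simp only [graphMap, Fin.snoc_castSucc]
    fun_prop

lemma continuous_hypChart (m : ℕ) : Continuous (hypChart m) :=
  (continuous_graphMap m).subtype_mk _

instance (m : ℕ) : PreconnectedSpace (Hyp m) :=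
  (hypChart_surjective m).denseRange.preconnectedSpace (continuous_hypChart m)

end HypOT

/-! ### Discrete groups of Lorentz transformations and the quotient -/

namespace HypOT

open Filter Topology

variable {m : ℕ}

/-- The Lorentz transformations moving `x` to within a bounded distance of `y` have bounded
entries. -/
lemma exists_bound_of_neg_lorentz_le (x y : Hyp m) (R : ℝ) :
    ∃ C : ℝ, ∀ A ∈ lorentzGroup m, -lorentz (A.1 *ᵥ x.1) y.1 ≤ R → ∀ i j, |A.1 i j| ≤ C := by
  -- every basis vector is a difference of two future vectors
  let f : Fin (m + 1) → ℝ := (2 : ℝ) • Pi.single (Fin.last m) 1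
  have hf : f ∈ futureCone m := by
    constructor <;> simp [f, lorentz, Fin.castSucc_ne_last]
  have hg : ∀ j, Pi.single j 1 + f ∈ futureCone m := by
    intro j
    refine Fin.lastCases ?_ (fun j => ?_) j
    · constructor <;> simp [f, lorentz, Fin.castSucc_ne_last] <;> norm_num
    · constructor <;>
        simp [f, lorentz, Pi.single_apply, Fin.castSucc_ne_last, (Fin.castSucc_ne_last _).symm]
      norm_num
  let D : (Fin (m + 1) → ℝ) → ℝ := fun g => 2 * (2 * y.1 (Fin.last m) * R) * -lorentz g x.1
  have key : ∀ A ∈ lorentzGroup m, -lorentz (A.1 *ᵥ x.1) y.1 ≤ R → ∀ g ∈ futureCone m, ∀ i,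
      |(A.1 *ᵥ g) i| ≤ D g := by
    intro A hA hR g hg i
    have hAx : A.1 *ᵥ x.1 ∈ futureCone m := (hA.2 _).2 x.mem_futureCone
    have hAg : A.1 *ᵥ g ∈ futureCone m := (hA.2 _).2 hg
    refine (abs_apply_le_last hAg i).trans ?_
    have h1 := last_mul_le_of_mem_futureCone hAx y.mem_futureCone
    have h2 := last_mul_le_of_mem_futureCone hAg hAx
    rw [y.2.1, neg_neg, mul_one] at h1
    rw [hA.1, hA.1, x.2.1, neg_neg, mul_one] at h2
    have h3 : (A.1 *ᵥ x.1) (Fin.last m) ≤ 2 * y.1 (Fin.last m) * R :=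
      h1.trans (mul_le_mul_of_nonneg_left hR (by linarith [y.2.2]))
    refine h2.trans ?_
    exact mul_le_mul_of_nonneg_right (by linarith) (neg_lorentz_pos hg x.mem_futureCone).le
  obtain ⟨C, hC⟩ := (Set.finite_range fun j => D (Pi.single j 1 + f) + D f).bddAbove
  refine ⟨C, fun A hA hR i j => ?_⟩
  have h1 := key A hA hR _ (hg j) i
  have h2 := key A hA hR _ hf i
  have h3 : A.1 i j = (A.1 *ᵥ (Pi.single j 1 + f)) i - (A.1 *ᵥ f) i := by
    rw [mulVec_add]
    simp
  rw [h3]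
  exact (abs_sub _ _).trans ((add_le_add h1 h2).trans (hC ⟨j, rfl⟩))

section Group

variable (Γ : Subgroup (lorentzGroup m))

lemma lorentz_smul_smul (β : Γ) (x y : Hyp m) :
    lorentz (β • x).1 (β • y).1 = lorentz x.1 y.1 := β.1.2.1 x.1 y.1

lemma lorentz_smul_eq (β : Γ) (x y : Hyp m) :
    lorentz (β • x).1 y.1 = lorentz x.1 (β⁻¹ • y).1 := by
  rw [← lorentz_smul_smul Γ β x, smul_inv_smul]

instance : ContinuousConstSMul Γ (Hyp m) where
  continuous_const_smul β := by
    refine Continuous.subtype_mk (f := fun x : Hyp m => β.1.1.1 *ᵥ x.1) ?_ _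
    exact continuous_const.matrix_mulVec continuous_subtype_val

/-- Proper discontinuity of a discrete group: it is closed in the general linear group, and the
Lorentz transformations `β` with `-⟨β x, y⟩ ≤ R` are contained in a compact set. -/
lemma finite_neg_lorentz_le [DiscreteTopology Γ] (x y : Hyp m) (R : ℝ) :
    {β : Γ | -lorentz (β • x).1 y.1 ≤ R}.Finite := by
  let j : Γ → GL (Fin (m + 1)) ℝ := fun β => β.1.1
  have hj : IsInducing j := IsInducing.subtypeVal.comp IsInducing.subtypeVal
  have hjinj : Function.Injective j := Subtype.val_injective.comp Subtype.val_injective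
  let Γ' : Subgroup (GL (Fin (m + 1)) ℝ) := Γ.map (lorentzGroup m).subtype
  have hrange : (Γ' : Set (GL (Fin (m + 1)) ℝ)) = j '' Set.univ := by
    ext A
    simp [Γ', j]
  have hdisc : IsDiscrete (Γ' : Set (GL (Fin (m + 1)) ℝ)) :=
    hrange ▸ IsDiscrete.univ.image hj
  have : DiscreteTopology Γ' := isDiscrete_iff_discreteTopology.1 hdisc
  have hclosed : IsClosed (Γ' : Set (GL (Fin (m + 1)) ℝ)) := Subgroup.isClosed_of_discrete
  obtain ⟨C, hC⟩ := exists_bound_of_neg_lorentz_le x y R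
  obtain ⟨C', hC'⟩ := exists_bound_of_neg_lorentz_le y x R
  let box : ℝ → Set (Matrix (Fin (m + 1)) (Fin (m + 1)) ℝ) := fun C =>
    Set.univ.pi fun _ => Set.univ.pi fun _ => Set.Icc (-C) C
  have hbox : ∀ C, IsCompact (box C) := fun C =>
    isCompact_univ_pi fun _ => isCompact_univ_pi fun _ => isCompact_Icc
  have hK : IsCompact (Units.embedProduct (Matrix (Fin (m + 1)) (Fin (m + 1)) ℝ) ⁻¹'
      (box C ×ˢ (MulOpposite.opHomeomorph '' box C'))) :=
    Units.isClosedEmbedding_embedProduct.isCompact_preimage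
      ((hbox C).prod ((hbox C').image (MulOpposite.opHomeomorph).continuous))
  have hfin := (hK.inter_right hclosed).finite (hdisc.mono Set.inter_subset_right)
  refine Set.Finite.of_finite_image (hfin.subset ?_) hjinj.injOn (f := j)
  rintro _ ⟨β, hβ, rfl⟩
  refine ⟨⟨?_, ?_⟩, hrange ▸ ⟨β, trivial, rfl⟩⟩
  · intro a _ b _
    exact abs_le.1 (hC _ β.1.2 hβ a b)
  · refine ⟨(j β)⁻¹.1, fun a _ b _ => abs_le.1 (hC' _ (β⁻¹).1.2 ?_ a b), rfl⟩
    change -lorentz (β • x).1 y.1 ≤ R at hβ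
    rw [lorentz_smul_eq, lorentz_comm] at hβ
    exact hβ

lemma proj_eq_iff {x y : Hyp m} : proj Γ x = proj Γ y ↔ ∃ β : Γ, β • y = x :=
  Quotient.eq.trans (MulAction.orbitRel_apply.trans Iff.rfl)

lemma proj_smul (β : Γ) (x : Hyp m) : proj Γ (β • x) = proj Γ x := (proj_eq_iff Γ).2 ⟨β, rfl⟩

lemma continuous_proj : Continuous (proj Γ) := continuous_quot_mk

lemma proj_surjective : Function.Surjective (proj Γ) := Quotient.mk_surjective

instance : PreconnectedSpace (HypQuot Γ) :=
  (proj_surjective Γ).denseRange.preconnectedSpace (continuous_proj Γ)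

/-- The covering map is injective on a neighbourhood of every point. -/
lemma exists_isOpen_injOn_proj [DiscreteTopology Γ]
    (hfree : ∀ (γ : Γ) (x : Hyp m), γ • x = x → γ = 1) (y₀ : Hyp m) :
    ∃ U : Set (Hyp m), IsOpen U ∧ y₀ ∈ U ∧ Set.InjOn (proj Γ) U := by
  have hfin := finite_neg_lorentz_le Γ y₀ y₀ 4
  have h1 := eventually_mul_neg_lorentz_le y₀ (a := 1 / 2) (by norm_num)
  -- the finitely many nontrivial group elements that matter separate points near `y₀`
  have h2 : ∀ᶠ z in 𝓝 y₀ ×ˢ 𝓝 y₀, ∀ β ∈ {β : Γ | -lorentz (β • y₀).1 y₀.1 ≤ 4},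
      β ≠ 1 → β • z.1 ≠ z.2 := by
    refine (hfin.eventually_all (p := fun (β : Γ) (z : Hyp m × Hyp m) =>
      β ≠ 1 → β • z.1 ≠ z.2)).2 fun β _ => ?_
    by_cases hβ : β = 1
    · exact .of_forall fun z h => absurd hβ h
    · have hne : β • y₀ ≠ y₀ := fun h => hβ (hfree β y₀ h)
      rw [← nhds_prod_eq]
      have hc : Continuous fun z : Hyp m × Hyp m => β • z.1 := continuous_fst.const_smul β
      filter_upwards [(isOpen_ne_fun hc continuous_snd).mem_nhds hne] with z hz _
      exact hz
  obtain ⟨V, hV, hVV⟩ := eventually_prod_self_iff'.1 h2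
  obtain ⟨U, hU, hUo, hyU⟩ := mem_nhds_iff.1 (inter_mem hV h1)
  refine ⟨U, hUo, hyU, fun a ha b hb hab => ?_⟩
  obtain ⟨β, hβ⟩ := (proj_eq_iff Γ).1 hab
  have hβ4 : -lorentz (β • y₀).1 y₀.1 ≤ 4 := by
    have e1 := ((hU ha).2 _ (β • y₀).mem_futureCone).1
    have e2 := ((hU hb).2 _ (β⁻¹ • a).mem_futureCone).1
    have e3 : lorentz (β⁻¹ • a).1 b.1 = -1 := by
      rw [← hβ, inv_smul_smul, b.2.1]
    have e4 : lorentz (β • y₀).1 a.1 = lorentz (β⁻¹ • a).1 y₀.1 := by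
      rw [lorentz_smul_eq, lorentz_comm]
    rw [e3] at e2
    rw [e4] at e1
    linarith
  by_contra hne
  by_cases h1β : β = 1
  · rw [h1β, one_smul] at hβ
    exact hne hβ.symm
  · exact hVV b (hU hb).1 a (hU ha).1 β hβ4 h1β hβ

/-- The cost of two points of the quotient is the least value of `log (-⟨·, ·⟩)` on the fibres. -/
lemma cost_proj [DiscreteTopology Γ] (x y : Hyp m) :
    (∀ β : Γ, cost (proj Γ y) (proj Γ x) ≤ Real.log (-lorentz (β • x).1 y.1)) ∧
    ∃ β : Γ, cost (proj Γ y) (proj Γ x) = Real.log (-lorentz (β • x).1 y.1) := by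
  obtain ⟨β₀, h₀, hmin⟩ := Set.exists_min_image _ (fun β : Γ => -lorentz (β • x).1 y.1)
    (finite_neg_lorentz_le Γ x y (-lorentz x.1 y.1)) ⟨1, by simp⟩
  have hle : ∀ β : Γ, -lorentz (β₀ • x).1 y.1 ≤ -lorentz (β • x).1 y.1 := fun β => by
    by_cases h : -lorentz (β • x).1 y.1 ≤ -lorentz x.1 y.1
    · exact hmin β h
    · exact le_trans h₀ (not_le.1 h).le
  have hpos : ∀ β : Γ, 0 < -lorentz (β • x).1 y.1 := fun β =>
    zero_lt_one.trans_le (one_le_neg_lorentz _ _)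
  have hleast : IsLeast {r | ∃ a b : Hyp m, proj Γ a = proj Γ y ∧ proj Γ b = proj Γ x ∧
      hypDist a b = r} (hypDist y (β₀ • x)) := by
    refine ⟨⟨y, β₀ • x, rfl, proj_smul Γ _ _, rfl⟩, ?_⟩
    rintro _ ⟨a, b, ha, hb, rfl⟩
    obtain ⟨γ, rfl⟩ := (proj_eq_iff Γ).1 ha
    obtain ⟨δ, rfl⟩ := (proj_eq_iff Γ).1 hb
    have : lorentz (γ • y).1 (δ • x).1 = lorentz ((γ⁻¹ * δ) • x).1 y.1 := by
      rw [lorentz_smul_eq, lorentz_comm, mul_smul]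
    unfold hypDist
    rw [this, lorentz_comm, Real.arcosh_le_arcosh (hpos _) (hpos _)]
    exact hle _
  have hcost : cost (proj Γ y) (proj Γ x) = Real.log (-lorentz (β₀ • x).1 y.1) := by
    unfold cost quotDist
    rw [hleast.csInf_eq, hypDist, Real.cosh_arcosh (one_le_neg_lorentz _ _), lorentz_comm]
  exact ⟨fun β => hcost ▸ Real.log_le_log (hpos _) (hle β), β₀, hcost⟩

/-- A point of the quotient has a lift realizing its cost to the projection of `x`. -/
lemma exists_lift_cost_eq [DiscreteTopology Γ] (x : Hyp m) (q : HypQuot Γ) :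
    ∃ y, proj Γ y = q ∧ cost q (proj Γ x) = Real.log (-lorentz x.1 y.1) := by
  obtain ⟨y, rfl⟩ := proj_surjective Γ q
  obtain ⟨β, hβ⟩ := (cost_proj Γ x y).2
  refine ⟨β⁻¹ • y, proj_smul Γ _ _, ?_⟩
  rw [hβ, lorentz_smul_eq]

lemma cost_nonneg [DiscreteTopology Γ] (p q : HypQuot Γ) : 0 ≤ cost p q := by
  obtain ⟨x, rfl⟩ := proj_surjective Γ q
  obtain ⟨y, rfl, h⟩ := exists_lift_cost_eq Γ x p
  rw [h]
  exact Real.log_nonneg (one_le_neg_lorentz _ _)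

lemma cost_eq_zero_iff [DiscreteTopology Γ] (p q : HypQuot Γ) : cost p q = 0 ↔ p = q := by
  constructor
  · intro h0
    obtain ⟨x, rfl⟩ := proj_surjective Γ q
    obtain ⟨y, rfl, h⟩ := exists_lift_cost_eq Γ x p
    by_contra hne
    have hxy : x ≠ y := fun h => hne (h ▸ rfl)
    have := Real.log_pos (one_lt_neg_lorentz hxy)
    linarith
  · rintro rfl
    obtain ⟨x, rfl⟩ := proj_surjective Γ p
    refine le_antisymm ?_ (cost_nonneg Γ _ _)
    have := (cost_proj Γ x x).1 1
    rwa [one_smul, x.2.1, neg_neg, Real.log_one] at this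

lemma continuous_cost [DiscreteTopology Γ] (q : HypQuot Γ) :
    Continuous fun p : HypQuot Γ => cost p q := by
  obtain ⟨x, rfl⟩ := proj_surjective Γ q
  refine (isQuotientMap_quot_mk (X := Hyp m)).continuous_iff.2 ?_
  change Continuous fun y => cost (proj Γ y) (proj Γ x)
  refine continuous_iff_continuousAt.2 fun y₀ => Metric.tendsto_nhds.2 fun ε hε => ?_
  have ha : Real.exp (-(ε / 2)) < 1 := Real.exp_lt_one_iff.2 (by linarith)
  have key : ∀ y z : Hyp m, (∀ u ∈ futureCone m,
      Real.exp (-(ε / 2)) * -lorentz u y.1 ≤ -lorentz u z.1) →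
      cost (proj Γ y) (proj Γ x) - ε / 2 ≤ cost (proj Γ z) (proj Γ x) := by
    intro y z h
    obtain ⟨β, hβ⟩ := (cost_proj Γ x z).2
    have h1 := (cost_proj Γ x y).1 β
    have hpos : 0 < -lorentz (β • x).1 y.1 := zero_lt_one.trans_le (one_le_neg_lorentz _ _)
    have h2 := Real.log_le_log (mul_pos (Real.exp_pos _) hpos) (h _ (β • x).mem_futureCone)
    rw [Real.log_mul (Real.exp_ne_zero _) hpos.ne', Real.log_exp] at h2
    linarith
  filter_upwards [eventually_mul_neg_lorentz_le y₀ ha] with y hy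
  have h1 := key y₀ y fun u hu => (hy u hu).1
  have h2 := key y y₀ fun u hu => (hy u hu).2
  rw [Real.dist_eq, abs_lt]
  constructor <;> linarith

variable {k : ℕ} (x : Fin k → Hyp m)

/-- The costs of transport to the points `p_i = π_Γ(x_i)`. -/
noncomputable def siteCost (i : Fin k) (q : HypQuot Γ) : ℝ := cost q (proj Γ (x i))

/-- The cells `W_i(φ)` are the Laguerre cells of the hyperbolic transport cost. -/
lemma cell_eq_laguerreCell [DiscreteTopology Γ] (φ : Fin k → ℝ) (i : Fin k) :
    cell Γ x φ i = SemidiscreteOT.laguerreCell (siteCost Γ x) φ i := by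
  have hpos : ∀ a b : Hyp m, 0 < -lorentz a.1 b.1 := fun a b =>
    zero_lt_one.trans_le (one_le_neg_lorentz _ _)
  have key : ∀ (a b y : Hyp m) (s t : ℝ),
      Real.exp (-t) * lorentz b.1 y.1 ≤ Real.exp (-s) * lorentz a.1 y.1 ↔
      Real.log (-lorentz a.1 y.1) - s ≤ Real.log (-lorentz b.1 y.1) - t := by
    intro a b y s t
    rw [← neg_le_neg_iff, ← mul_neg, ← mul_neg, ← Real.log_le_log_iff
      (mul_pos (Real.exp_pos _) (hpos _ _)) (mul_pos (Real.exp_pos _) (hpos _ _)),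
      Real.log_mul (Real.exp_ne_zero _) (hpos _ _).ne',
      Real.log_mul (Real.exp_ne_zero _) (hpos _ _).ne', Real.log_exp, Real.log_exp]
    constructor <;> intro h <;> linarith
  ext q
  constructor
  · rintro ⟨y, hy, rfl⟩ j
    obtain ⟨β, hβ⟩ := (cost_proj Γ (x j) y).2
    have h1 := (key _ _ _ _ _).1 (hy j β)
    have h2 := (cost_proj Γ (x i) y).1 1
    rw [one_smul] at h2
    simp only [siteCost, hβ]
    linarith
  · intro hq
    obtain ⟨y, rfl, hy⟩ := exists_lift_cost_eq Γ (x i) q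
    refine ⟨y, fun j β => (key _ _ _ _ _).2 ?_, rfl⟩
    have h1 := (cost_proj Γ (x j) y).1 β
    have h2 := hq j
    simp only [siteCost, hy] at h2
    linarith

/-- The heights for which the `i`-th open cell is nonempty form a convex set. A point of this cell
lifts to a future vector `z` with `-⟨x i, z⟩ = 1` and `log (-⟨β x j, z⟩) > φ j - φ i`, and these
conditions survive convex combinations since the logarithm is concave. -/
lemma exists_strict_convex_comb [DiscreteTopology Γ] {φ ψ : Fin k → ℝ} {i : Fin k} {a b : ℝ}
    (ha : 0 < a) (hb : 0 < b) (hab : a + b = 1)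
    (hφ : ∃ q, ∀ j, j ≠ i → siteCost Γ x i q - φ i < siteCost Γ x j q - φ j)
    (hψ : ∃ q, ∀ j, j ≠ i → siteCost Γ x i q - ψ i < siteCost Γ x j q - ψ j) :
    ∃ q, ∀ j, j ≠ i → siteCost Γ x i q - (a • φ + b • ψ) i <
      siteCost Γ x j q - (a • φ + b • ψ) j := by
  have lift : ∀ χ : Fin k → ℝ,
      (∃ q, ∀ j, j ≠ i → siteCost Γ x i q - χ i < siteCost Γ x j q - χ j) →
      ∃ z ∈ futureCone m, -lorentz (x i).1 z = 1 ∧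
        ∀ j, j ≠ i → ∀ β : Γ, χ j - χ i < Real.log (-lorentz (β • x j).1 z) := by
    rintro χ ⟨q, hq⟩
    obtain ⟨y, rfl, hy⟩ := exists_lift_cost_eq Γ (x i) q
    have hpos : ∀ u : Hyp m, 0 < -lorentz u.1 y.1 := fun u =>
      zero_lt_one.trans_le (one_le_neg_lorentz _ _)
    refine ⟨(-lorentz (x i).1 y.1)⁻¹ • y.1,
      smul_mem_futureCone y.mem_futureCone (inv_pos.2 (hpos _)), ?_, fun j hj β => ?_⟩
    · rw [lorentz_smul_right, ← mul_neg, inv_mul_cancel₀ (hpos _).ne']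
    · have h1 := hq j hj
      have h2 := (cost_proj Γ (x j) y).1 β
      rw [lorentz_smul_right, ← mul_neg, Real.log_mul (inv_pos.2 (hpos _)).ne' (hpos _).ne',
        Real.log_inv]
      simp only [siteCost, hy] at h1
      linarith
  obtain ⟨z, hz, hz1, hzlog⟩ := lift φ hφ
  obtain ⟨z', hz', hz1', hzlog'⟩ := lift ψ hψ
  have hcomb : a • z + b • z' ∈ futureCone m :=
    add_mem_futureCone (smul_mem_futureCone hz ha) (smul_mem_futureCone hz' hb)
  obtain ⟨y, s, hs, hy⟩ := exists_smul_hyp hcomb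
  have hlin : ∀ u, -lorentz u y.1 = s * (a * -lorentz u z + b * -lorentz u z') := fun u => by
    rw [hy, lorentz_smul_right, lorentz_add_right, lorentz_smul_right, lorentz_smul_right]
    ring
  refine ⟨proj Γ y, fun j hj => ?_⟩
  obtain ⟨β, hβ⟩ := (cost_proj Γ (x j) y).2
  have h1 := (cost_proj Γ (x i) y).1 1
  rw [one_smul, hlin, hz1, hz1', mul_one, mul_one, hab, mul_one] at h1
  have p1 := neg_lorentz_pos (β • x j).mem_futureCone hz
  have p2 := neg_lorentz_pos (β • x j).mem_futureCone hz'
  rw [hlin, Real.log_mul hs.ne' (add_pos (mul_pos ha p1) (mul_pos hb p2)).ne'] at hβ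
  have h2 := strictConcaveOn_log_Ioi.concaveOn.2 p1 p2 ha.le hb.le hab
  simp only [smul_eq_mul] at h2
  have h3 := mul_lt_mul_of_pos_left (hzlog j hj β) ha
  have h4 := mul_lt_mul_of_pos_left (hzlog' j hj β) hb
  simp only [siteCost, Pi.add_apply, Pi.smul_apply, smul_eq_mul]
  linarith

end Group

end HypOT

/-! ### The Riemannian measures -/

namespace HypOT

open Filter Topology

variable {m : ℕ}

/-- The time coordinate `√(1 + |u|²)` is strictly convex: on a chord of the hyperboloid
`-⟨z, z⟩ > 1`. -/
lemma strictConvexOn_sqrt_one_add_sum_sq (m : ℕ) :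
    StrictConvexOn ℝ Set.univ fun u : Fin m → ℝ => √(1 + ∑ i, u i ^ 2) := by
  refine ⟨convex_univ, fun u _ v _ huv a b ha hb hab => ?_⟩
  have hne : hypChart m u ≠ hypChart m v := fun h => huv (funext fun i => by
    have := congrFun (congrArg Subtype.val h) i.castSucc
    simpa [hypChart, graphMap] using this)
  have h1 := one_lt_neg_lorentz hne
  have hu : √(1 + ∑ i, u i ^ 2) ^ 2 = 1 + ∑ i, u i ^ 2 := Real.sq_sqrt (by positivity)
  have hv : √(1 + ∑ i, v i ^ 2) ^ 2 = 1 + ∑ i, v i ^ 2 := Real.sq_sqrt (by positivity)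
  have hupos : 0 < √(1 + ∑ i, u i ^ 2) := Real.sqrt_pos.2 (by positivity)
  have hvpos : 0 < √(1 + ∑ i, v i ^ 2) := Real.sqrt_pos.2 (by positivity)
  simp only [hypChart, lorentz, graphMap, Fin.snoc_castSucc, Fin.snoc_last] at h1
  simp only [smul_eq_mul]
  set s := √(1 + ∑ i, u i ^ 2)
  set t := √(1 + ∑ i, v i ^ 2)
  rw [Real.sqrt_lt' (by positivity)]
  have hsum : ∑ i, (a • u + b • v) i ^ 2 =
      a ^ 2 * ∑ i, u i ^ 2 + 2 * (a * b) * ∑ i, u i * v i + b ^ 2 * ∑ i, v i ^ 2 := by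
    simp only [Finset.mul_sum, ← Finset.sum_add_distrib]
    exact Finset.sum_congr rfl fun i _ => by
      simp only [Pi.add_apply, Pi.smul_apply, smul_eq_mul]; ring
  rw [hsum, show ∑ i, u i ^ 2 = s ^ 2 - 1 by linarith, show ∑ i, v i ^ 2 = t ^ 2 - 1 by linarith]
  have hab2 : a ^ 2 + 2 * (a * b) + b ^ 2 = 1 := by
    calc a ^ 2 + 2 * (a * b) + b ^ 2 = (a + b) ^ 2 := by ring
      _ = 1 := by rw [hab, one_pow]
  have h2 := mul_lt_mul_of_pos_left h1 (mul_pos ha hb)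
  nlinarith

/-- Hyperplane sections of the hyperboloid are negligible. For a hyperplane that is not vertical the
section is a level set of a strictly convex function, which lies in the frontier of the
corresponding convex sublevel set. -/
lemma volume_lorentz_graphMap_eq_zero {v : Fin (m + 1) → ℝ} (hv : v ≠ 0) :
    volume {u : Fin m → ℝ | lorentz v (graphMap m u) = 0} = 0 := by
  simp only [lorentz, graphMap, Fin.snoc_castSucc, Fin.snoc_last]
  by_cases hl : v (Fin.last m) = 0
  · let L : (Fin m → ℝ) →ₗ[ℝ] ℝ := ∑ i : Fin m, v i.castSucc • LinearMap.proj i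
    have hL : ∀ u, L u = ∑ i : Fin m, v i.castSucc * u i := fun u => by simp [L]
    have hker : LinearMap.ker L ≠ ⊤ := by
      intro htop
      refine hv (funext fun i => Fin.lastCases hl (fun i => ?_) i)
      have : L (Pi.single i 1) = 0 := by
        rw [LinearMap.ker_eq_top.1 htop]; rfl
      rw [hL] at this
      simpa [Pi.single_apply] using this
    have := Measure.addHaar_submodule volume (LinearMap.ker L) hker
    convert this using 2
    ext u
    simp [hL, hl]
  · let F : (Fin m → ℝ) → ℝ := fun u =>
      √(1 + ∑ i, u i ^ 2) - ∑ i : Fin m, v i.castSucc / v (Fin.last m) * u i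
    have hF : StrictConvexOn ℝ Set.univ F := by
      refine (strictConvexOn_sqrt_one_add_sum_sq m).sub_concaveOn
        ⟨convex_univ, fun u _ w _ a b _ _ _ => le_of_eq ?_⟩
      simp only [smul_eq_mul, Finset.mul_sum, ← Finset.sum_add_distrib, Pi.add_apply, Pi.smul_apply]
      exact Finset.sum_congr rfl fun i _ => by ring
    have hC : Convex ℝ {u | F u ≤ 0} := by
      simpa using hF.convexOn.convex_le 0
    refine measure_mono_null (fun u hu => ?_) (hC.addHaar_frontier volume)
    have hFu : F u = 0 := by
      have hu' : ∑ i : Fin m, v i.castSucc * u i - v (Fin.last m) * √(1 + ∑ i, u i ^ 2) = 0 := hu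
      have : ∑ i : Fin m, v i.castSucc / v (Fin.last m) * u i =
          (∑ i : Fin m, v i.castSucc * u i) / v (Fin.last m) := by
        rw [Finset.sum_div]
        exact Finset.sum_congr rfl fun i _ => by ring
      simp only [F, this]
      rw [show ∑ i : Fin m, v i.castSucc * u i = v (Fin.last m) * √(1 + ∑ i, u i ^ 2) by linarith]
      field_simp
      ring
    refine ⟨subset_closure hFu.le, fun hint => ?_⟩
    have hu0 : u ≠ 0 := by
      rintro rfl
      simp [F] at hFu
    have hcont : Continuous fun t : ℝ => (1 + t) • u := by fun_prop
    have hev : ∀ᶠ t : ℝ in 𝓝 0, (1 + t) • u ∈ {u | F u ≤ 0} := by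
      refine hcont.continuousAt.eventually ?_
      beta_reduce
      rw [add_zero, one_smul]
      exact mem_interior_iff_mem_nhds.1 hint
    obtain ⟨ε, hε, hball⟩ := Metric.eventually_nhds_iff.1 hev
    have h1 : F ((1 + ε / 2) • u) ≤ 0 := hball (by simp [abs_of_pos hε, hε])
    have h2 : F ((1 + -(ε / 2)) • u) ≤ 0 := hball (by simp [abs_of_pos hε, hε])
    have hne : (1 + ε / 2) • u ≠ (1 + -(ε / 2)) • u := fun h => by
      have := smul_left_injective ℝ hu0 h
      linarith
    have h3 := hF.2 (Set.mem_univ _) (Set.mem_univ _) hne (one_half_pos (α := ℝ))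
      (one_half_pos (α := ℝ)) (add_halves 1)
    have h4 : (1 / 2 : ℝ) • (1 + ε / 2) • u + (1 / 2 : ℝ) • (1 + -(ε / 2)) • u = u := by module
    rw [h4, hFu] at h3
    simp only [smul_eq_mul] at h3
    linarith

lemma fderiv_graphMap_apply (u v : Fin m → ℝ) : fderiv ℝ (graphMap m) u v =
    Fin.snoc v ((∑ i, u i * v i) / √(1 + ∑ i, u i ^ 2)) := by
  have hpos : (1 + ∑ i, u i ^ 2) ≠ 0 := by positivity
  have hd : ∀ i, DifferentiableAt ℝ (fun w => graphMap m w i) u := fun i => by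
    refine Fin.lastCases ?_ (fun i => ?_) i
    · simp only [graphMap, Fin.snoc_last]
      exact DifferentiableAt.sqrt (by fun_prop) hpos
    · simp only [graphMap, Fin.snoc_castSucc]
      fun_prop
  have hline := ((differentiableAt_pi.2 hd).hasFDerivAt.hasLineDerivAt v)
  rw [HasLineDerivAt, hasDerivAt_pi] at hline
  ext i
  refine (hline i).unique ?_
  refine Fin.lastCases ?_ (fun i => ?_) i
  · have hsum : HasDerivAt (fun t : ℝ => 1 + ∑ i, (u i + t * v i) ^ 2)
        (2 * ∑ i, u i * v i) 0 := by
      have : ∀ i, HasDerivAt (fun t : ℝ => (u i + t * v i) ^ 2) (2 * (u i * v i)) 0 := fun i => by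
        have h := (((hasDerivAt_id (0 : ℝ)).mul_const (v i)).const_add (u i)).pow 2
        convert! h using 1
        simp
        ring
      rw [Finset.mul_sum]
      exact (HasDerivAt.fun_sum fun i _ => this i).const_add 1
    have h := hsum.sqrt (by simpa using hpos)
    simp only [graphMap, Fin.snoc_last, Pi.add_apply, Pi.smul_apply, smul_eq_mul]
    convert! h using 1
    simp only [zero_mul, add_zero]
    rw [mul_div_mul_left _ _ two_ne_zero]
  · simp only [graphMap, Fin.snoc_castSucc, Pi.add_apply, Pi.smul_apply, smul_eq_mul]
    simpa using ((hasDerivAt_id (0 : ℝ)).mul_const (v i)).const_add (u i)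

lemma metricMatrix_apply (u : Fin m → ℝ) (i j : Fin m) : metricMatrix m u i j =
    (if i = j then 1 else 0) - u i * u j / (1 + ∑ i, u i ^ 2) := by
  have hpos : (0 : ℝ) < 1 + ∑ i, u i ^ 2 := by positivity
  simp only [metricMatrix, of_apply, lorentz, fderiv_graphMap_apply, Fin.snoc_castSucc,
    Fin.snoc_last, div_mul_div_comm, Real.mul_self_sqrt hpos.le]
  simp only [Pi.single_apply, mul_ite, mul_one, mul_zero,
    Finset.sum_ite_eq', Finset.mem_univ, if_true]
  simp only [eq_comm (a := j)]

lemma continuous_metricMatrix (m : ℕ) : Continuous (metricMatrix m) := by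
  refine continuous_matrix fun i j => ?_
  simp only [metricMatrix_apply]
  refine continuous_const.sub (Continuous.div (by fun_prop) (by fun_prop) fun u => ?_)
  positivity

/-- The metric of hyperbolic space is positive definite, by the Cauchy–Schwarz inequality. -/
lemma posDef_metricMatrix (u : Fin m → ℝ) : (metricMatrix m u).PosDef := by
  refine .of_dotProduct_mulVec_pos ?_ fun v hv => ?_
  · ext i j
    simp only [conjTranspose_apply, metricMatrix_apply, star_trivial, mul_comm (u j), eq_comm]
  · have hpos : (0 : ℝ) < 1 + ∑ i, u i ^ 2 := by positivity
    have hform : star v ⬝ᵥ (metricMatrix m u *ᵥ v) =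
        ∑ i, v i ^ 2 - (∑ i, u i * v i) ^ 2 / (1 + ∑ i, u i ^ 2) := by
      have hmul : ∀ i, (metricMatrix m u *ᵥ v) i =
          v i - u i * (∑ j, u j * v j) / (1 + ∑ i, u i ^ 2) := fun i => by
        simp only [mulVec, dotProduct, metricMatrix_apply, sub_mul, Finset.sum_sub_distrib,
          ite_mul, one_mul, zero_mul, Finset.sum_ite_eq, Finset.mem_univ, if_true, Finset.mul_sum,
          Finset.sum_div]
        congr 1
        exact Finset.sum_congr rfl fun j _ => by ring
      simp only [dotProduct, star_trivial, hmul, mul_sub, Finset.sum_sub_distrib]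
      congr 1
      · exact Finset.sum_congr rfl fun i _ => by ring
      · rw [pow_two, Finset.sum_mul, Finset.sum_div]
        exact Finset.sum_congr rfl fun j _ => by ring
    have hvpos : 0 < ∑ i, v i ^ 2 := by
      obtain ⟨i, hi⟩ := Function.ne_iff.1 hv
      exact Finset.sum_pos' (fun i _ => sq_nonneg _) ⟨i, Finset.mem_univ i, by
        have : v i ≠ 0 := hi
        positivity⟩
    have hcs := Finset.sum_mul_sq_le_sq_mul_sq Finset.univ u v
    rw [hform, sub_pos, div_lt_iff₀ hpos]
    nlinarith

lemma measurable_hypDensity (m : ℕ) :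
    Measurable fun u => ENNReal.ofReal (√(metricMatrix m u).det) :=
  (continuous_metricMatrix m).matrix_det.sqrt.measurable.ennreal_ofReal

instance (m : ℕ) : (hypMeasure m).IsOpenPosMeasure := by
  have hac : (volume : Measure (Fin m → ℝ)) ≪
      volume.withDensity fun u => ENNReal.ofReal (√(metricMatrix m u).det) :=
    withDensity_absolutelyContinuous' (measurable_hypDensity m).aemeasurable
      (.of_forall fun u => (ENNReal.ofReal_pos.2
        (Real.sqrt_pos.2 (posDef_metricMatrix u).det_pos)).ne')
  have := hac.isOpenPosMeasure
  exact (continuous_hypChart m).isOpenPosMeasure_map (hypChart_surjective m)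

lemma hypMeasure_lorentz_eq_zero {v : Fin (m + 1) → ℝ} (hv : v ≠ 0) :
    hypMeasure m {y | lorentz v y.1 = 0} = 0 := by
  have hclosed : IsClosed {y : Hyp m | lorentz v y.1 = 0} :=
    isClosed_eq (continuous_lorentz continuous_const continuous_subtype_val) continuous_const
  rw [hypMeasure, Measure.map_apply (continuous_hypChart m).measurable hclosed.measurableSet]
  exact withDensity_absolutelyContinuous _ _ (volume_lorentz_graphMap_eq_zero hv)

section Quotient

variable (Γ : Subgroup (lorentzGroup m))

/-- Sets with negligible preimage under the covering map are negligible in the quotient. -/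
lemma quotMeasure_eq_zero {N : Set (HypQuot Γ)} (hN : MeasurableSet N)
    (h : hypMeasure m (proj Γ ⁻¹' N) = 0) : quotMeasure Γ N = 0 := by
  have hproj : Measurable (proj Γ) := (continuous_proj Γ).measurable
  -- each of the measures in the supremum is carried by the complement of `N`
  have hle : quotMeasure Γ ≤ (quotMeasure Γ).restrict Nᶜ := by
    conv_lhs => rw [quotMeasure]
    refine iSup_le fun B => iSup_le fun hB => iSup_le fun hinj => ?_
    refine Measure.le_iff.2 fun s hs => ?_
    rw [Measure.restrict_apply hs]
    have hB' : ((hypMeasure m).restrict B).map (proj Γ) ≤ quotMeasure Γ :=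
      le_iSup_of_le B (le_iSup_of_le hB (le_iSup_of_le hinj le_rfl))
    refine le_trans ?_ (hB' (s ∩ Nᶜ))
    have h0 : ((hypMeasure m).restrict B).map (proj Γ) N = 0 := by
      rw [Measure.map_apply hproj hN]
      exact Measure.absolutelyContinuous_of_le Measure.restrict_le_self h
    rw [← Set.sdiff_eq, measure_sdiff_null h0]
  have := hle N
  rwa [Measure.restrict_apply hN, Set.inter_compl_self, measure_empty, nonpos_iff_eq_zero] at this

lemma isOpenPosMeasure_quotMeasure [DiscreteTopology Γ]
    (hfree : ∀ (γ : Γ) (x : Hyp m), γ • x = x → γ = 1) : (quotMeasure Γ).IsOpenPosMeasure := by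
  refine ⟨fun U hU ⟨q, hq⟩ => ?_⟩
  obtain ⟨y, rfl⟩ := proj_surjective Γ q
  obtain ⟨V, hV, hyV, hinj⟩ := exists_isOpen_injOn_proj Γ hfree y
  have hle : ((hypMeasure m).restrict V).map (proj Γ) ≤ quotMeasure Γ :=
    le_iSup_of_le V (le_iSup_of_le hV.measurableSet (le_iSup_of_le hinj le_rfl))
  have hUo : IsOpen (proj Γ ⁻¹' U) := hU.preimage (continuous_proj Γ)
  have h1 := hle U
  rw [Measure.map_apply (continuous_proj Γ).measurable hU.measurableSet,
    Measure.restrict_apply hUo.measurableSet] at h1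
  exact (((hUo.inter hV).measure_pos (hypMeasure m) ⟨y, hq, hyV⟩).trans_le h1).ne'

lemma countable_of_discrete [DiscreteTopology Γ] (x : Hyp m) : Countable Γ := by
  rw [← Set.countable_univ_iff]
  refine (Set.countable_iUnion fun n : ℕ => (finite_neg_lorentz_le Γ x x n).countable).mono
    fun β _ => ?_
  obtain ⟨n, hn⟩ := exists_nat_ge (-lorentz (β • x).1 x.1)
  exact Set.mem_iUnion.2 ⟨n, hn⟩

/-- The set where the difference of the costs to two distinct points takes a given value is
negligible: it lifts to a countable union of hyperplane sections. -/
lemma quotMeasure_cost_sub_cost_eq_zero [DiscreteTopology Γ] {x x' : Hyp m}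
    (hne : proj Γ x ≠ proj Γ x') (a : ℝ) :
    quotMeasure Γ {q | cost q (proj Γ x) - cost q (proj Γ x') = a} = 0 := by
  have := countable_of_discrete Γ x
  have hclosed : IsClosed {q : HypQuot Γ | cost q (proj Γ x) - cost q (proj Γ x') = a} :=
    isClosed_eq ((continuous_cost Γ _).sub (continuous_cost Γ _)) continuous_const
  refine quotMeasure_eq_zero Γ hclosed.measurableSet ?_
  refine measure_mono_null (t := ⋃ (β : Γ) (β' : Γ),
    {y | lorentz ((β • x).1 - Real.exp a • (β' • x').1) y.1 = 0}) (fun y hy => ?_) ?_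
  · obtain ⟨β, hβ⟩ := (cost_proj Γ x y).2
    obtain ⟨β', hβ'⟩ := (cost_proj Γ x' y).2
    have hy' : cost (proj Γ y) (proj Γ x) - cost (proj Γ y) (proj Γ x') = a := hy
    have h1 : 0 < -lorentz (β • x).1 y.1 := zero_lt_one.trans_le (one_le_neg_lorentz _ _)
    have h2 : 0 < -lorentz (β' • x').1 y.1 := zero_lt_one.trans_le (one_le_neg_lorentz _ _)
    have h3 : -lorentz (β • x).1 y.1 = Real.exp a * -lorentz (β' • x').1 y.1 := by
      rw [← Real.exp_log h1, ← Real.exp_log h2, ← hβ, ← hβ', ← Real.exp_add, ← hy']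
      ring_nf
    refine Set.mem_iUnion₂.2 ⟨β, β', ?_⟩
    simp only [Set.mem_ofPred_eq]
    rw [lorentz_sub_left, lorentz_smul_left]
    linarith
  · refine measure_iUnion_null fun β => measure_iUnion_null fun β' =>
      hypMeasure_lorentz_eq_zero fun h => hne ?_
    have hval : (β • x).1 = Real.exp a • (β' • x').1 := sub_eq_zero.1 h
    have hnorm := (β • x).2.1
    rw [hval, lorentz_smul_left, lorentz_smul_right, (β' • x').2.1] at hnorm
    have hexp : Real.exp a = 1 := by nlinarith [Real.exp_pos a]
    rw [hexp, one_smul] at hval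
    rw [← proj_smul Γ β x, ← proj_smul Γ β' x', Subtype.ext hval]

/-- The costs of transport to distinct points of a compact quotient form a generic family for every
absolutely continuous measure. -/
lemma isGenericCost_siteCost [DiscreteTopology Γ] [CompactSpace (HypQuot Γ)] {k : ℕ}
    {x : Fin k → Hyp m} (hx : Function.Injective fun i => proj Γ (x i))
    {μ : Measure (HypQuot Γ)} (hμ : μ ≪ quotMeasure Γ) :
    SemidiscreteOT.IsGenericCost μ (siteCost Γ x) where
  measurable i := (continuous_cost Γ _).measurable
  bounded := by
    have h : ∀ i, ∃ C, ∀ q, |siteCost Γ x i q| ≤ C := fun i => by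
      obtain ⟨C, hC⟩ := isCompact_univ.exists_bound_of_continuousOn
        (continuous_cost Γ (proj Γ (x i))).continuousOn
      exact ⟨C, fun q => hC q trivial⟩
    choose C hC using h
    obtain ⟨D, hD⟩ := (Set.finite_range C).bddAbove
    exact ⟨D, fun i q => (hC i q).trans (hD ⟨i, rfl⟩)⟩
  null_tie i j hij a := hμ (quotMeasure_cost_sub_cost_eq_zero Γ (hx.ne hij) a)

end Quotient

end HypOT

/-! ### The energy and the optimal map -/

namespace HypOT

variable {m k : ℕ} (Γ : Subgroup (lorentzGroup m)) [DiscreteTopology Γ]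
  (μ : Measure (HypQuot Γ)) (x : Fin k → Hyp m)

lemma cellForm_eq_massForm :
    cellForm Γ μ x = SemidiscreteOT.massForm μ (siteCost Γ x) := by
  ext1 φ
  simp only [cellForm, SemidiscreteOT.massForm, cell_eq_laguerreCell]

/-- A height vector is admissible if and only if all the open cells are nonempty. -/
lemma mem_admissible_iff [IsProbabilityMeasure μ] [μ.IsOpenPosMeasure]
    (hc : SemidiscreteOT.IsGenericCost μ (siteCost Γ x)) (φ : Fin k → ℝ) :
    φ ∈ admissible Γ μ x ↔
      ∀ i, ∃ q, ∀ j, j ≠ i → siteCost Γ x i q - φ i < siteCost Γ x j q - φ j := by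
  refine forall_congr' fun i => ?_
  rw [cell_eq_laguerreCell]
  refine ⟨hc.exists_strict_of_pos, fun ⟨q, hq⟩ => ?_⟩
  let V : Set (HypQuot Γ) := ⋂ j ∈ Finset.univ.filter (· ≠ i),
    {q | siteCost Γ x i q - φ i < siteCost Γ x j q - φ j}
  have hV : IsOpen V := isOpen_biInter_finset fun j _ =>
    isOpen_lt ((continuous_cost Γ _).sub continuous_const)
      ((continuous_cost Γ _).sub continuous_const)
  have hVmem : ∀ q, q ∈ V ↔ ∀ j, j ≠ i → siteCost Γ x i q - φ i < siteCost Γ x j q - φ j :=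
    fun q => by simp [V]
  have hsub : V ⊆ SemidiscreteOT.laguerreCell (siteCost Γ x) φ i := fun q hq j => by
    by_cases hj : j = i
    · rw [hj]
    · exact ((hVmem q).1 hq j hj).le
  exact ENNReal.toReal_pos
    ((hV.measure_pos μ ⟨q, (hVmem q).2 hq⟩).trans_le (measure_mono hsub)).ne' (measure_ne_top _ _)

/-- The form `∑ i, μ(W_i(φ)) dφ_i` is exact, with the potential of semidiscrete transport as a
primitive. -/
lemma curveIntegral_cellForm [Nonempty (Fin k)] [IsProbabilityMeasure μ]
    (hc : SemidiscreteOT.IsGenericCost μ (siteCost Γ x)) {φ ψ : Fin k → ℝ} (γ : Path φ ψ)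
    (hγ : ContDiffOn ℝ 1 γ.extend (Set.Icc 0 1)) :
    CurveIntegrable (cellForm Γ μ x) γ ∧ curveIntegral (cellForm Γ μ x) γ =
      SemidiscreteOT.potential μ (siteCost Γ x) ψ -
        SemidiscreteOT.potential μ (siteCost Γ x) φ := by
  rw [cellForm_eq_massForm]
  exact curveIntegral_eq_sub_of_hasFDerivAt hc.continuous_massForm hc.hasFDerivAt_potential γ hγ

lemma energy_eq [Nonempty (Fin k)] [IsProbabilityMeasure μ]
    (hc : SemidiscreteOT.IsGenericCost μ (siteCost Γ x)) (w φ : Fin k → ℝ) :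
    energy Γ μ x w φ = SemidiscreteOT.potential μ (siteCost Γ x) φ -
      SemidiscreteOT.potential μ (siteCost Γ x) 0 - ∑ i, φ i * w i := by
  rw [energy, (curveIntegral_cellForm Γ μ x hc _ ?_).2]
  have hline : ContDiff ℝ 1 fun t : ℝ => t • φ := contDiff_id.smul contDiff_const
  refine hline.contDiffOn.congr fun t ht => ?_
  rw [Path.eqOn_extend_segment 0 φ ht, AffineMap.lineMap_apply_module, smul_zero, zero_add]

end HypOT

open HypOT

theorem theorem3 {m k : ℕ} (Γ : Subgroup (HypOT.lorentzGroup m)) (hΓ : HypOT.IsCocompactFree Γ)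
    (f : HypOT.HypQuot Γ → ℝ) (hf : Continuous f) (hf0 : ∀ q, 0 < f q)
    (μ : Measure (HypOT.HypQuot Γ)) [IsProbabilityMeasure μ]
    (hμ : μ = (HypOT.quotMeasure Γ).withDensity fun q => ENNReal.ofReal (f q))
    (p : Fin k → HypOT.HypQuot Γ) (hp : Function.Injective p)
    (w : Fin k → ℝ) (hw : ∀ i, 0 < w i) (hmass : μ.real Set.univ = ∑ i, w i)
    (x : Fin k → HypOT.Hyp m) (hx : ∀ i, HypOT.proj Γ (x i) = p i) :
    -- existence of a height vector
    (∃ φ : Fin k → ℝ, ∀ i, μ.real (HypOT.cell Γ x φ i) = w i) ∧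
    -- the energy is well defined on the admissible space and convex
    (0 : Fin k → ℝ) ∈ HypOT.admissible Γ μ x ∧
    (∀ φ ∈ HypOT.admissible Γ μ x, ∀ c : Path 0 φ, (∀ t, c t ∈ HypOT.admissible Γ μ x) →
      ContDiffOn ℝ 1 c.extend (Set.Icc 0 1) →
      CurveIntegrable (HypOT.cellForm Γ μ x) c ∧
      curveIntegral (HypOT.cellForm Γ μ x) c - ∑ i, φ i * w i = HypOT.energy Γ μ x w φ) ∧
    ConvexOn ℝ (HypOT.admissible Γ μ x) (HypOT.energy Γ μ x w) ∧
    ∀ φ : Fin k → ℝ, (∀ i, μ.real (HypOT.cell Γ x φ i) = w i) →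
      -- uniqueness up to a constant vector
      (∀ φ' : Fin k → ℝ, (∀ i, μ.real (HypOT.cell Γ x φ' i) = w i) ↔
        ∃ a : ℝ, ∀ i, φ' i = φ i + a) ∧
      -- minimality of the energy
      φ ∈ HypOT.admissible Γ μ x ∧
      IsMinOn (HypOT.energy Γ μ x w) (HypOT.admissible Γ μ x) φ ∧
      -- the map sending `W_i(φ)` to `p_i` is defined almost everywhere and optimal
      (∀ᵐ q ∂μ, ∃! i, q ∈ HypOT.cell Γ x φ i) ∧
      (∃ T : HypOT.HypQuot Γ → HypOT.HypQuot Γ, Measurable T ∧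
        ∀ᵐ q ∂μ, ∀ i, q ∈ HypOT.cell Γ x φ i → T q = p i) ∧
      ∀ T : HypOT.HypQuot Γ → HypOT.HypQuot Γ, Measurable T →
        (∀ᵐ q ∂μ, ∀ i, q ∈ HypOT.cell Γ x φ i → T q = p i) →
        HypOT.IsOptimalTransportMap μ (HypOT.discreteMeasure p w) T := by
  have := hΓ.discrete
  have := hΓ.compact
  have hp' : Function.Injective fun i => proj Γ (x i) := by simpa only [hx] using hp
  have hac : μ ≪ quotMeasure Γ := hμ ▸ withDensity_absolutelyContinuous _ _
  have hac' : quotMeasure Γ ≪ μ := hμ ▸ withDensity_absolutelyContinuous'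
    hf.measurable.ennreal_ofReal.aemeasurable
    (.of_forall fun q => (ENNReal.ofReal_pos.2 (hf0 q)).ne')
  have := isOpenPosMeasure_quotMeasure Γ hΓ.free
  have : μ.IsOpenPosMeasure := hac'.isOpenPosMeasure
  have hc := isGenericCost_siteCost Γ hp' hac
  have hsum : ∑ i, w i = 1 := by rw [← hmass, probReal_univ]
  have : Nonempty (Fin k) := by
    by_contra h
    rw [not_nonempty_iff] at h
    simp at hsum
  have hcost : ∀ i q, cost q (p i) = siteCost Γ x i q := fun i q => by rw [siteCost, hx]
  have hps : ∀ i, MeasurableSet {p i} := fun i => by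
    have : {p i} = (fun q => cost q (p i)) ⁻¹' {0} := by
      ext q
      simp [cost_eq_zero_iff]
    rw [this]
    exact (continuous_cost Γ (p i)).measurable (measurableSet_singleton 0)
  have hE := energy_eq Γ μ x hc w
  simp only [cell_eq_laguerreCell]
  refine ⟨hc.exists_heights hw hsum, ?_, fun φ _ γ _ hγ => ?_, ⟨?_, ?_⟩, fun φ hφ => ?_⟩
  · refine (mem_admissible_iff Γ μ x hc 0).2 fun i => ⟨p i, fun j hj => ?_⟩
    rw [← hcost, ← hcost, (cost_eq_zero_iff Γ _ _).2 rfl]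
    have h : cost (p i) (p j) ≠ 0 := fun h => hj (hp ((cost_eq_zero_iff Γ _ _).1 h)).symm
    simpa using lt_of_le_of_ne (cost_nonneg Γ _ _) h.symm
  · have h := curveIntegral_cellForm Γ μ x hc γ hγ
    exact ⟨h.1, by rw [h.2, hE]⟩
  · refine convex_iff_forall_pos.2 fun φ hφ ψ hψ a b ha hb hab => ?_
    rw [mem_admissible_iff Γ μ x hc] at hφ hψ ⊢
    exact fun i => exists_strict_convex_comb Γ x ha hb hab (hφ i) (hψ i)
  · intro φ _ ψ _ a b ha hb hab
    have h := hc.convexOn_potential.2 (Set.mem_univ φ) (Set.mem_univ ψ) ha hb hab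
    have hlin : ∑ i, (a • φ + b • ψ) i * w i = a * ∑ i, φ i * w i + b * ∑ i, ψ i * w i := by
      simp only [Finset.mul_sum, ← Finset.sum_add_distrib, Pi.add_apply, Pi.smul_apply, smul_eq_mul]
      exact Finset.sum_congr rfl fun i _ => by ring
    have h0 := congrArg (· * SemidiscreteOT.potential μ (siteCost Γ x) 0) hab
    simp only [hE, hlin, smul_eq_mul] at h h0 ⊢
    linarith
  · refine ⟨fun φ' => ⟨fun hφ' => hc.heights_unique (fun i => continuous_cost Γ _) hw hφ hφ', ?_⟩,
      fun i => ?_, fun ψ _ => ?_, hc.ae_existsUnique φ, hc.exists_measurable_selection φ p,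
      fun T hT hTp => ?_⟩
    · rintro ⟨a, ha⟩ i
      rw [funext ha, SemidiscreteOT.laguerreCell_add_const, hφ]
    · rw [cell_eq_laguerreCell, hφ]
      exact hw i
    · have h := hc.potential_add_massForm_le φ ψ
      simp only [SemidiscreteOT.massForm_apply, hφ, Pi.sub_apply, mul_sub, Finset.sum_sub_distrib]
        at h
      simp only [Set.mem_ofPred_eq, hE, mul_comm _ (w _)]
      linarith
    · have hTmp := hc.measurePreserving_of_eq_on_cells hφ hT hTp
      have hw0 : ∀ i, 0 ≤ w i := fun i => (hw i).le
      exact ⟨hTmp, (hc.integrable_cost_and_integral_height hcost hp hps hw0 φ hTmp).2.1, fun S hS =>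
        ⟨(hc.integrable_cost_and_integral_height hcost hp hps hw0 φ hS).2.1,
          hc.integral_cost_le hcost hp hps hw0 hφ hT hTp hS⟩⟩
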